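/- Let $\mathcal A$ be a finite or countable set with $|\mathcal A|>1$, let $\Omega=\mathcal A^{\mathbb N}$ ($\mathbb N=\{0,1,2,\dots\}$) with the $\sigma$-algebra $\mathcal F$ generated by the coordinates, let $T:\Omega\to\Omega$ be the left shift, and let $\mathbb P$ be a $T$-invariant probability measure on $(\Omega,\mathcal F)$ that is not a point mass. Assume that $\mathbb P$ is $\psi$-mixing: there are $\psi_m\ge 0$ ($m\ge 0$) with $\psi_m\to 0$ such that $$|\mathbb P(E\cap T^{-(n+m)}F)-\mathbb P(E)\mathbb P(F)|\le \psi_m\,\mathbb P(E)\,\mathbb P(F)$$ for all $m,n\in\mathbb N$, all $E$ in the $\sigma$-algebra generated by the coordinates $0,\dots,n-1$, and all $F\in\mathcal F$. Fix $t>0$, $\ell\ge 1$ and integers $1\le d_1<\dots<d_\ell$. For $\omega\in\Omega$ and $n\ge 1$ let $A_n^\omega=\{\gamma\in\Omega:\gamma_j=\omega_j\text{ for }0\le j<n\}$, and for measurable $A\subset\Omega$ and an integer $N\ge 0$ let $$S_N^A=\sum_{k=1}^N\prod_{j=1}^{\ell}1_A\circ T^{d_jk}.$$ Let $\omega\in\Omega$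 be a periodic point of $T$ in the support of $\mathbb P$, i.e. $T^r\omega=\omega$ for some $r\ge1$ and $\mathbb P(A_n^\omega)>0$ for all $n\ge1$. For $n\ge 1$ let $N_n^\omega=\lfloor t\,\mathbb P(A_n^\omega)^{-\ell}\rfloor$ and let $\mu_n$ be the distribution of $S_{N_n^\omega}^{A_n^\omega}$ under $\mathbb P$, a probability measure on $\mathbb N$. Then: (a) The sequence $\{\mu_n\}_{n\ge1}$ is tight. (b) Let $\mu$ be a probability measure on $\mathbb R$ such that $\mu_{n_k}\to\mu$ in distribution as $k\to\infty$ for some subsequence $\{\mu_{n_k}\}$. Then $\mu=CP(\tau,\theta)$ for some $0<\tau\le t$ and some probability measure $\theta$ on $\mathbb N$. Here $CP(\tau,\theta)=\sum_{j=0}^{\infty}e^{-\tau}\frac{\tau^j}{j!}\,\theta^{*j}$ is the compound Poisson distribution, where $\theta^{*j}$ is the $j$-fold convolution of $\theta$ and $\theta^{*0}=\delta_0$. -/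

import Mathlib

open MeasureTheory ProbabilityTheory Filter Topology
open scoped NNReal ENNReal

namespace CylinderReturns

noncomputable section

/-- The left shift `T` on the sequence space `𝒜^ℕ`. -/
def shift {𝒜 : Type*} (x : ℕ → 𝒜) : ℕ → 𝒜 := fun i => x (i + 1)

/-- The σ-algebra `ℱ_J` generated by the events `{x_j = a}`, `j ∈ J`, `a ∈ 𝒜`. -/
abbrev coordSigma (𝒜 : Type*) (J : Set ℕ) : MeasurableSpace (ℕ → 𝒜) :=
  MeasurableSpace.generateFrom {s | ∃ j ∈ J, ∃ a : 𝒜, s = {x | x j = a}}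

/-- `P` is ψ-mixing: for some `ψ_m → 0`,
`|P(E ∩ T^{-(n+m)} F) - P(E) P(F)| ≤ ψ_m P(E) P(F)` for all `m, n ≥ 0`,
all `E ∈ ℱ_{{0, …, n-1}}` and all measurable `F`. -/
def IsPsiMixing {𝒜 : Type*} [MeasurableSpace 𝒜] (P : Measure (ℕ → 𝒜)) : Prop :=
  ∃ ψ : ℕ → ℝ, (∀ m, 0 ≤ ψ m) ∧ Tendsto ψ atTop (𝓝 0) ∧
    ∀ (m n : ℕ) (E F : Set (ℕ → 𝒜)),
      MeasurableSet[coordSigma 𝒜 (Set.Iio n)] E → MeasurableSet F →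
        |P.real (E ∩ shift^[n + m] ⁻¹' F) - P.real E * P.real F|
          ≤ ψ m * P.real E * P.real F

/-- The cylinder `A_n^ω = [ω_0, …, ω_{n-1}]`. -/
def cylinder {𝒜 : Type*} (ω : ℕ → 𝒜) (n : ℕ) : Set (ℕ → 𝒜) :=
  {x | ∀ j < n, x j = ω j}

/-- `X_k^A = ∏_j 1_A ∘ T^{d_j k}`. -/
def multiReturn {𝒜 : Type*} {l : ℕ} (d : Fin l → ℕ) (A : Set (ℕ → 𝒜)) (k : ℕ)
    (x : ℕ → 𝒜) : ℕ :=
  ∏ j : Fin l, A.indicator (fun _ => 1) (shift^[d j * k] x)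

/-- `S_N^A = ∑_{k=1}^N X_k^A`. -/
def returnCount {𝒜 : Type*} {l : ℕ} (d : Fin l → ℕ) (A : Set (ℕ → 𝒜)) (N : ℕ)
    (x : ℕ → 𝒜) : ℕ :=
  ∑ k ∈ Finset.Icc 1 N, multiReturn d A k x

/-- `N_n^ω = [t P(A_n^ω)^{-ℓ}]`. -/
def returnTime {𝒜 : Type*} [MeasurableSpace 𝒜] (P : Measure (ℕ → 𝒜)) (l : ℕ) (t : ℝ)
    (ω : ℕ → 𝒜) (n : ℕ) : ℕ :=
  ⌊t * ((P.real (cylinder ω n)) ^ l)⁻¹⌋₊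

theorem measurable_shift {𝒜 : Type*} [MeasurableSpace 𝒜] :
    Measurable (shift : (ℕ → 𝒜) → (ℕ → 𝒜)) :=
  measurable_pi_lambda _ fun i => measurable_pi_apply (i + 1)

theorem measurableSet_cylinder {𝒜 : Type*} [MeasurableSpace 𝒜] [DiscreteMeasurableSpace 𝒜]
    (ω : ℕ → 𝒜) (n : ℕ) : MeasurableSet (cylinder ω n) := by
  have h : cylinder ω n = ⋂ j ∈ Set.Iio n, (fun x : ℕ → 𝒜 => x j) ⁻¹' {ω j} := by
    ext x
    simp [cylinder]
  rw [h]
  exact MeasurableSet.biInter (Set.to_countable _)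
    fun j _ => measurable_pi_apply j (MeasurableSet.singleton _)

theorem measurable_returnCount {𝒜 : Type*} [MeasurableSpace 𝒜] {l : ℕ} (d : Fin l → ℕ)
    {A : Set (ℕ → 𝒜)} (hA : MeasurableSet A) (N : ℕ) : Measurable (returnCount d A N) := by
  unfold returnCount multiReturn
  refine Finset.measurable_sum _ fun k _ => Finset.measurable_prod _ fun j _ => ?_
  exact (measurable_const.indicator hA).comp (measurable_shift.iterate _)

/-- `μ_n`, the distribution under `P` of `S_{N_n^ω}^{A_n^ω}`, a probability measure on `ℕ`. -/
def countLaw {𝒜 : Type*} [MeasurableSpace 𝒜] [DiscreteMeasurableSpace 𝒜]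
    (P : Measure (ℕ → 𝒜)) [IsProbabilityMeasure P] {l : ℕ} (d : Fin l → ℕ) (t : ℝ)
    (ω : ℕ → 𝒜) (n : ℕ) : ProbabilityMeasure ℕ :=
  ⟨P.map (returnCount d (cylinder ω n) (returnTime P l t ω n)),
    Measure.isProbabilityMeasure_map
      (measurable_returnCount d (measurableSet_cylinder ω n) _).aemeasurable⟩

/-- A probability measure on `ℕ` regarded as a probability measure on `ℝ`. -/
def onReal (μ : ProbabilityMeasure ℕ) : ProbabilityMeasure ℝ :=
  μ.map (f := fun k : ℕ => (k : ℝ)) measurable_from_top.aemeasurable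

/-- The `j`-fold convolution of a measure on `ℕ` with itself. -/
def convPow (θ : Measure ℕ) : ℕ → Measure ℕ
  | 0 => Measure.dirac 0
  | j + 1 => (convPow θ j).conv θ

/-- The compound Poisson distribution `CP(τ, θ) = ∑_{j ≥ 0} Pois(τ){j} • θ^{*j}`, the law of
`η_1 + ⋯ + η_W` with `W ∼ Pois(τ)` and `η_i` i.i.d. of law `θ`, independent of `W`. -/
def compoundPoisson (τ : ℝ≥0) (θ : Measure ℕ) : Measure ℕ :=
  Measure.sum fun j => poissonMeasure τ {j} • convPow θ j

end

end CylinderReturns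

open CylinderReturns

set_option linter.unusedSectionVars false

namespace CylinderReturns

/-! Write p for the measure of the n-cylinder. Periodicity of ω and ψ-mixing make p decay
geometrically, so n² p → 0. Cut the times up to N ≈ t p^{-ℓ} into blocks of length b = n², each
ending in a gap of 2n, and let W_i be the number of multiple returns in block i. The times outside
the blocks contribute little in expectation: the gaps are a fraction 2/n of the whole.

The returns in block i read coordinates near d_a k for every a, so a block is not located in one
place. Still, all but boundedly many of the earlier blocks read coordinates far from those of block
m, and finitely many cuts then decouple them from it (`Interlaced.lintegral_mul`). The exceptional
blocks are dropped at the cost of second moments E[W_i W_m] ≤ b² (κp)^{ℓ+1} and of squared first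
moments. Hence for 0 ≤ z ≤ 1 the generating function E z^S is close to exp(-∑ E(1 - z^{W_i}))
(`abs_integral_prod_sub_exp_le`, `tendsto_integral_pow_sub_exp`).

The exponent equals (1 - z) ∑ z^j Λ_j with Λ_j = ∑_i P(W_i > j). By Markov, (j + 1) Λ_j ≤ κ^ℓ t, so
along a subsequence Λ converges to some L with (j + 1) L_j ≤ t. Then L / t is the tail sequence of a
probability measure θ on ℕ, which may charge 0, and the limit of the generating functions is that of
CP(t, θ). Thus τ = t always works. Generating functions on (0, 1) determine a law on ℕ, which
identifies the given weak limit. Tightness is Markov's inequality for E S. -/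

/-- Up to the factor `κ`, events separated by a gap of length `g` are independent under `P`. -/
def QuasiIndep {𝒜 : Type*} [MeasurableSpace 𝒜] (P : Measure (ℕ → 𝒜)) (g : ℕ) (κ : ℝ≥0∞) :
    Prop :=
  ∀ (n : ℕ) (E F : Set (ℕ → 𝒜)), MeasurableSet[coordSigma 𝒜 (Set.Iio n)] E → MeasurableSet F →
    P (E ∩ shift^[n + g] ⁻¹' F) ≤ κ * (P E * P F) ∧
      P E * P F ≤ κ * P (E ∩ shift^[n + g] ⁻¹' F)

/-- The sequence equal to `x` before time `c` and to `y` from time `c` on. -/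
def splice {𝒜 : Type*} (c : ℕ) (x y : ℕ → 𝒜) : ℕ → 𝒜 := fun j => if j < c then x j else y j

theorem measurable_splice {𝒜 : Type*} [MeasurableSpace 𝒜] (c : ℕ) :
    Measurable fun q : (ℕ → 𝒜) × (ℕ → 𝒜) => splice c q.1 q.2 := by
  refine measurable_pi_lambda _ fun j => ?_
  unfold splice
  split_ifs
  · exact (measurable_pi_apply j).comp measurable_fst
  · exact (measurable_pi_apply j).comp measurable_snd

theorem shift_iterate_apply {𝒜 : Type*} (k : ℕ) (x : ℕ → 𝒜) (i : ℕ) :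
    shift^[k] x i = x (k + i) := by
  induction k generalizing x with
  | zero => simp
  | succ k ih => rw [Function.iterate_succ_apply, ih, shift]; congr 1; omega

theorem measurableSet_coordSigma_forall {𝒜 : Type*} {J : Set ℕ} {n : ℕ} (q : Fin n → ℕ)
    (hq : ∀ i, q i ∈ J) (w : Fin n → 𝒜) :
    MeasurableSet[coordSigma 𝒜 J] {x : ℕ → 𝒜 | ∀ i, x (q i) = w i} := by
  have : {x : ℕ → 𝒜 | ∀ i, x (q i) = w i} = ⋂ i, {x | x (q i) = w i} := by ext; simp
  rw [this]
  exact MeasurableSet.iInter fun i =>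
    MeasurableSpace.measurableSet_generateFrom ⟨q i, hq i, w i, rfl⟩

/-! ### Decoupling functions of separated sets of coordinates -/

section Mixing

variable {𝒜 : Type*} [Countable 𝒜] [MeasurableSpace 𝒜] [DiscreteMeasurableSpace 𝒜]
  {P : Measure (ℕ → 𝒜)} [IsProbabilityMeasure P]

theorem lintegral_eq_tsum_prefix (P : Measure (ℕ → 𝒜)) (c : ℕ) (h : (ℕ → 𝒜) → ℝ≥0∞) :
    ∫⁻ x, h x ∂P = ∑' w : Fin c → 𝒜, ∫⁻ x in {x | ∀ i : Fin c, x i = w i}, h x ∂P := by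
  have hm : ∀ w : Fin c → 𝒜, MeasurableSet {x : ℕ → 𝒜 | ∀ i : Fin c, x i = w i} := by
    intro w
    have : {x : ℕ → 𝒜 | ∀ i : Fin c, x i = w i} = ⋂ i : Fin c, (fun x => x (i : ℕ)) ⁻¹' {w i} := by
      ext; simp
    rw [this]
    exact MeasurableSet.iInter fun i => measurable_pi_apply _ (MeasurableSet.singleton _)
  rw [← lintegral_iUnion hm]
  · have : (⋃ w : Fin c → 𝒜, {x : ℕ → 𝒜 | ∀ i : Fin c, x i = w i}) = Set.univ :=
      Set.eq_univ_of_forall fun x => Set.mem_iUnion.2 ⟨fun i => x i, fun i => rfl⟩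
    rw [this, Measure.restrict_univ]
  · intro w w' hww
    refine Set.disjoint_left.2 fun x hx hx' => hww ?_
    ext i
    rw [← hx i, ← hx' i]

/-- Mixing permits resampling everything from time c + g on. As the alphabet is countable, the
integral splits over the prefixes of length c; on a fixed prefix, h is a function of the shifted
point alone, and `QuasiIndep` compares the image of the restricted measure with a multiple of P. -/
theorem lintegral_splice (hinv : MeasurePreserving (shift : (ℕ → 𝒜) → (ℕ → 𝒜)) P P)
    {g : ℕ} {κ : ℝ≥0∞} (hQ : QuasiIndep P g κ) (c : ℕ) {h : (ℕ → 𝒜) → ℝ≥0∞} (hh : Measurable h)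
    (hdep : DependsOn h {j | j < c ∨ c + g ≤ j}) :
    ∫⁻ x, h x ∂P ≤ κ * ∫⁻ x, ∫⁻ y, h (splice c x y) ∂P ∂P ∧
      ∫⁻ x, ∫⁻ y, h (splice c x y) ∂P ∂P ≤ κ * ∫⁻ x, h x ∂P := by
  set C : (Fin c → 𝒜) → Set (ℕ → 𝒜) := fun w => {x | ∀ i : Fin c, x i = w i} with hC
  have hCm : ∀ w, MeasurableSet[coordSigma 𝒜 (Set.Iio c)] (C w) := fun w =>
    measurableSet_coordSigma_forall (fun i : Fin c => (i : ℕ)) (fun i => i.2) w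
  have hCm' : ∀ w, MeasurableSet (C w) := by
    intro w
    have : C w = ⋂ i : Fin c, (fun x => x (i : ℕ)) ⁻¹' {w i} := by
      ext; simp [hC]
    rw [this]
    exact MeasurableSet.iInter fun i => measurable_pi_apply _ (MeasurableSet.singleton _)
  -- Prefix w, then z placed from time c + g on. In the gap the truncated subtraction gives the
  -- irrelevant value z 0, which h does not see.
  set J : (Fin c → 𝒜) → (ℕ → 𝒜) → (ℕ → 𝒜) := fun w z j =>
    if hj : j < c then w ⟨j, hj⟩ else z (j - (c + g)) with hJ
  have hJm : ∀ w, Measurable (J w) := by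
    intro w
    refine measurable_pi_lambda _ fun j => ?_
    simp only [hJ]
    split_ifs
    · exact measurable_const
    · exact measurable_pi_apply _
  have hhJ : ∀ w, Measurable fun z => h (J w z) := fun w => hh.comp (hJm w)
  have hsh : MeasurePreserving (shift^[c + g] : (ℕ → 𝒜) → (ℕ → 𝒜)) P P := hinv.iterate _
  have h1 : ∀ w, ∫⁻ x in C w, h x ∂P
      = ∫⁻ z, h (J w z) ∂((P.restrict (C w)).map shift^[c + g]) := by
    intro w
    rw [lintegral_map (hhJ w) hsh.measurable]
    refine setLIntegral_congr_fun (hCm' w) fun x hx => ?_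
    refine hdep fun j hj => ?_
    simp only [hJ]
    split_ifs with hjc
    · exact hx ⟨j, hjc⟩
    · rw [shift_iterate_apply]
      congr 1
      rcases hj with hj | hj <;> omega
  have h2 : ∀ w, ∫⁻ x in C w, ∫⁻ y, h (splice c x y) ∂P ∂P = P (C w) * ∫⁻ z, h (J w z) ∂P := by
    intro w
    rw [← hsh.lintegral_comp (hhJ w), mul_comm, ← setLIntegral_const]
    refine setLIntegral_congr_fun (hCm' w) fun x hx => ?_
    refine lintegral_congr fun y => ?_
    refine hdep fun j hj => ?_
    simp only [hJ, splice]
    split_ifs with hjc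
    · exact hx ⟨j, hjc⟩
    · rw [shift_iterate_apply]
      congr 1
      rcases hj with hj | hj <;> omega
  have hle : ∀ w, (P.restrict (C w)).map shift^[c + g] ≤ κ • (P (C w) • P) := by
    intro w
    refine Measure.le_iff.2 fun F hF => ?_
    rw [Measure.map_apply hsh.measurable hF, Measure.restrict_apply (hsh.measurable hF),
      Set.inter_comm]
    exact (hQ c (C w) F (hCm w) hF).1
  have hge : ∀ w, P (C w) • P ≤ κ • (P.restrict (C w)).map shift^[c + g] := by
    intro w
    refine Measure.le_iff.2 fun F hF => ?_
    rw [Measure.smul_apply, Measure.smul_apply, Measure.map_apply hsh.measurable hF,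
      Measure.restrict_apply (hsh.measurable hF), Set.inter_comm]
    exact (hQ c (C w) F (hCm w) hF).2
  rw [lintegral_eq_tsum_prefix P c h,
    lintegral_eq_tsum_prefix P c (fun x => ∫⁻ y, h (splice c x y) ∂P), ← ENNReal.tsum_mul_left,
    ← ENNReal.tsum_mul_left]
  refine ⟨ENNReal.tsum_le_tsum fun w => ?_, ENNReal.tsum_le_tsum fun w => ?_⟩
  · rw [h1, h2]
    refine (lintegral_mono' (hle w) le_rfl).trans ?_
    rw [lintegral_smul_measure, lintegral_smul_measure]
    rfl
  · rw [h1, h2]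
    have := lintegral_mono' (hge w) (le_refl fun z => h (J w z))
    rwa [lintegral_smul_measure, lintegral_smul_measure] at this

/-- `U` and `V` can be told apart by `K` cuts, each followed by a gap of length `g`. -/
inductive Interlaced (g : ℕ) : ℕ → Set ℕ → Set ℕ → Prop
  | empty (V : Set ℕ) : Interlaced g 0 ∅ V
  | symm {K : ℕ} {U V : Set ℕ} : Interlaced g K U V → Interlaced g K V U
  | cut {K : ℕ} {U V : Set ℕ} (c : ℕ) : (∀ j ∈ U, j < c) → (∀ j ∈ V, j < c ∨ c + g ≤ j) →
      Interlaced g K U (V ∩ Set.Iio c) → Interlaced g (K + 1) U V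

/-- At a cut, u looks only at the past, so the future of v can be averaged out, leaving a function w
of the past and one cut fewer. Each cut costs κ twice: once to decouple the product, once to return
from ∫ w to ∫ v. -/
theorem Interlaced.lintegral_mul (hinv : MeasurePreserving (shift : (ℕ → 𝒜) → (ℕ → 𝒜)) P P)
    {g : ℕ} {κ : ℝ≥0∞} (hQ : QuasiIndep P g κ) {K : ℕ} {U V : Set ℕ} (hUV : Interlaced g K U V)
    (u v : (ℕ → 𝒜) → ℝ≥0∞) (hu : Measurable u) (hv : Measurable v) (hud : DependsOn u U)
    (hvd : DependsOn v V) :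
    ∫⁻ x, u x * v x ∂P ≤ κ ^ (2 * K) * ((∫⁻ x, u x ∂P) * ∫⁻ x, v x ∂P) ∧
      (∫⁻ x, u x ∂P) * (∫⁻ x, v x ∂P) ≤ κ ^ (2 * K) * ∫⁻ x, u x * v x ∂P := by
  induction hUV generalizing u v with
  | empty V =>
    have hc : ∀ x y, u x = u y := fun x y => hud fun j hj => absurd hj (Set.notMem_empty j)
    obtain ⟨x₀⟩ : Nonempty (ℕ → 𝒜) := by
      by_contra hne
      rw [not_nonempty_iff] at hne
      exact IsProbabilityMeasure.ne_zero P (Measure.eq_zero_of_isEmpty P)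
    have : u = fun _ => u x₀ := funext fun x => hc x x₀
    rw [this]
    simp [lintegral_const_mul _ hv]
  | symm _ ih =>
    have := ih v u hv hu hvd hud
    simpa only [mul_comm (u _), mul_comm (∫⁻ x, u x ∂P)] using this
  | @cut K U V c hU hV _ ih =>
    set w : (ℕ → 𝒜) → ℝ≥0∞ := fun x => ∫⁻ y, v (splice c x y) ∂P with hw
    have hwm : Measurable w := (hv.comp (measurable_splice c)).lintegral_prod_right'
    have hwd : DependsOn w (V ∩ Set.Iio c) := by
      intro x x' hxx
      refine lintegral_congr fun y => hvd fun j hj => ?_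
      simp only [splice]
      split_ifs with hjc
      · exact hxx j ⟨hj, hjc⟩
      · rfl
    have key : ∫⁻ x, ∫⁻ y, u (splice c x y) * v (splice c x y) ∂P ∂P = ∫⁻ x, u x * w x ∂P := by
      refine lintegral_congr fun x => ?_
      rw [hw, ← lintegral_const_mul]
      · refine lintegral_congr fun y => ?_
        congr 1
        refine hud fun j hj => ?_
        simp [splice, hU j hj]
      · exact hv.comp ((measurable_splice c).comp measurable_prodMk_left)
    have hd1 : DependsOn (fun x => u x * v x) {j | j < c ∨ c + g ≤ j} := by
      intro x y hxy
      have e1 : u x = u y := hud fun j hj => hxy j (Or.inl (hU j hj))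
      have e2 : v x = v y := hvd fun j hj => hxy j (hV j hj)
      simp only [e1, e2]
    have hd2 : DependsOn v {j | j < c ∨ c + g ≤ j} := fun x y hxy => hvd fun j hj => hxy j (hV j hj)
    obtain ⟨a1, a2⟩ := lintegral_splice hinv hQ c (hu.mul hv) hd1
    obtain ⟨b1, b2⟩ := lintegral_splice hinv hQ c hv hd2
    obtain ⟨c1, c2⟩ := ih u w hu hwm hud hwd
    simp only [Pi.mul_apply] at a1 a2
    rw [key] at a1 a2
    constructor
    · calc ∫⁻ x, u x * v x ∂P ≤ κ * ∫⁻ x, u x * w x ∂P := a1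
        _ ≤ κ * (κ ^ (2 * K) * ((∫⁻ x, u x ∂P) * ∫⁻ x, w x ∂P)) := by gcongr
        _ ≤ κ * (κ ^ (2 * K) * ((∫⁻ x, u x ∂P) * (κ * ∫⁻ x, v x ∂P))) := by gcongr
        _ = _ := by ring
    · calc (∫⁻ x, u x ∂P) * ∫⁻ x, v x ∂P ≤ (∫⁻ x, u x ∂P) * (κ * ∫⁻ x, w x ∂P) := by gcongr
        _ = κ * ((∫⁻ x, u x ∂P) * ∫⁻ x, w x ∂P) := by ring
        _ ≤ κ * (κ ^ (2 * K) * ∫⁻ x, u x * w x ∂P) := by gcongr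
        _ ≤ κ * (κ ^ (2 * K) * (κ * ∫⁻ x, u x * v x ∂P)) := by gcongr
        _ = _ := by ring

end Mixing

/-- The upper half of ψ-mixing at a gap of length `g`. -/
def UpperMix {𝒜 : Type*} [MeasurableSpace 𝒜] (P : Measure (ℕ → 𝒜)) (g : ℕ) (κ : ℝ) : Prop :=
  ∀ (n : ℕ) (E F : Set (ℕ → 𝒜)), MeasurableSet[coordSigma 𝒜 (Set.Iio n)] E → MeasurableSet F →
    P.real (E ∩ shift^[n + g] ⁻¹' F) ≤ κ * P.real E * P.real F

/-- The rate is κ = 1 + 2ψ: since (1 + 2ψ)(1 - ψ) ≥ 1 for 0 ≤ ψ ≤ 1/2, it also serves for the lower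
half of mixing once the gap is large. The upper half holds at every gap, including gap 0. -/
theorem IsPsiMixing.exists_rate {𝒜 : Type*} [MeasurableSpace 𝒜] {P : Measure (ℕ → 𝒜)}
    [IsProbabilityMeasure P] (h : IsPsiMixing P) :
    ∃ κ : ℕ → ℝ, (∀ g, 1 ≤ κ g) ∧ Tendsto κ atTop (𝓝 1) ∧ (∀ g, UpperMix P g (κ g)) ∧
      ∀ᶠ g in atTop, QuasiIndep P g (ENNReal.ofReal (κ g)) := by
  obtain ⟨ψ, h0, hψ, hm⟩ := h
  refine ⟨fun g => 1 + 2 * ψ g, fun g => by linarith [h0 g], ?_, ?_, ?_⟩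
  · simpa using (hψ.const_mul 2).const_add 1
  · intro g n E F hE hF
    have h1 := (abs_le.1 (hm g n E F hE hF)).2
    have h2 : 0 ≤ ψ g * P.real E * P.real F :=
      mul_nonneg (mul_nonneg (h0 g) measureReal_nonneg) measureReal_nonneg
    linarith
  · filter_upwards [hψ.eventually (gt_mem_nhds (show (0 : ℝ) < 1 / 2 by norm_num))] with g hg
    intro n E F hE hF
    obtain ⟨h2, h1⟩ := abs_le.1 (hm g n E F hE hF)
    set a := P.real (E ∩ shift^[n + g] ⁻¹' F) with ha
    have hb : 0 ≤ P.real E * P.real F := mul_nonneg measureReal_nonneg measureReal_nonneg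
    set b := P.real E * P.real F with hb'
    have ha0 : 0 ≤ a := measureReal_nonneg
    have e1 : P (E ∩ shift^[n + g] ⁻¹' F) = ENNReal.ofReal a := by simp [ha]
    have e2 : P E * P F = ENNReal.ofReal b := by
      rw [hb', ENNReal.ofReal_mul measureReal_nonneg]; simp
    have hκ : 0 ≤ 1 + 2 * ψ g := by linarith [h0 g]
    rw [e1, e2, ← ENNReal.ofReal_mul hκ, ← ENNReal.ofReal_mul hκ]
    rw [mul_assoc] at h1 h2
    have hψb : 0 ≤ ψ g * b := mul_nonneg (h0 g) hb
    constructor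
    · exact ENNReal.ofReal_le_ofReal (by linarith)
    · refine ENNReal.ofReal_le_ofReal ?_
      have h3 : (1 - ψ g) * b ≤ a := by linarith
      have h4 : (1 + 2 * ψ g) * ((1 - ψ g) * b) ≤ (1 + 2 * ψ g) * a :=
        mul_le_mul_of_nonneg_left h3 hκ
      have h5 : 0 ≤ ψ g * b * (1 - 2 * ψ g) := mul_nonneg hψb (by linarith)
      nlinarith

/-! ### Probabilities of multiple returns and decay of cylinders -/

section Bounds

variable {𝒜 : Type*} [Countable 𝒜] [MeasurableSpace 𝒜] [DiscreteMeasurableSpace 𝒜]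
  {P : Measure (ℕ → 𝒜)} [IsProbabilityMeasure P]

theorem measurableSet_coordSigma_cylinder (ω : ℕ → 𝒜) (n : ℕ) :
    MeasurableSet[coordSigma 𝒜 (Set.Iio n)] (cylinder ω n) := by
  have : cylinder ω n = {x | ∀ i : Fin n, x i = ω i} := by
    ext x
    exact ⟨fun h i => h i i.2, fun h j hj => h ⟨j, hj⟩⟩
  rw [this]
  exact measurableSet_coordSigma_forall (fun i : Fin n => (i : ℕ)) (fun i => i.2) fun i => ω i

theorem measurableSet_coordSigma_hit (ω : ℕ → 𝒜) {n q s : ℕ} (hs : q + n ≤ s) :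
    MeasurableSet[coordSigma 𝒜 (Set.Iio s)] {x | shift^[q] x ∈ cylinder ω n} := by
  have : {x | shift^[q] x ∈ cylinder ω n} = {x | ∀ i : Fin n, x (q + i) = ω i} := by
    ext x
    simp only [cylinder, Set.mem_ofPred_eq, shift_iterate_apply]
    exact ⟨fun h i => h i i.2, fun h j hj => h ⟨j, hj⟩⟩
  rw [this]
  exact measurableSet_coordSigma_forall (fun i : Fin n => q + (i : ℕ))
    (fun i => by have := i.2; simp only [Set.mem_Iio]; omega) fun i => ω i

theorem measurableSet_hit (ω : ℕ → 𝒜) (n q : ℕ) :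
    MeasurableSet {x | shift^[q] x ∈ cylinder ω n} :=
  (measurable_shift.iterate q) (measurableSet_cylinder ω n)

theorem real_hit (hinv : MeasurePreserving (shift : (ℕ → 𝒜) → (ℕ → 𝒜)) P P) (ω : ℕ → 𝒜)
    (n q : ℕ) : P.real {x | shift^[q] x ∈ cylinder ω n} = P.real (cylinder ω n) :=
  (hinv.iterate q).measureReal_preimage (measurableSet_cylinder ω n).nullMeasurableSet

theorem real_hits_le (hinv : MeasurePreserving (shift : (ℕ → 𝒜) → (ℕ → 𝒜)) P P) {g : ℕ} {κ : ℝ}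
    (hκ : 1 ≤ κ) (hU : UpperMix P g κ) (ω : ℕ → 𝒜) (n : ℕ) (Q : Finset ℕ)
    (hsep : ∀ q ∈ Q, ∀ q' ∈ Q, q < q' → q + n + g ≤ q') :
    P.real {x | ∀ q ∈ Q, shift^[q] x ∈ cylinder ω n} ≤ (κ * P.real (cylinder ω n)) ^ Q.card := by
  induction Q using Finset.induction_on_max with
  | empty => simp
  | insert a Q hlt ih =>
    have hp : 0 ≤ P.real (cylinder ω n) := measureReal_nonneg
    have hκ0 : 0 ≤ κ := by linarith
    have ha : a ∉ Q := fun h => lt_irrefl _ (hlt a h)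
    have ih' := ih fun q hq q' hq' => hsep q (Finset.mem_insert_of_mem hq) q'
      (Finset.mem_insert_of_mem hq')
    have hset : {x | ∀ q ∈ insert a Q, shift^[q] x ∈ cylinder ω n}
        = {x | ∀ q ∈ Q, shift^[q] x ∈ cylinder ω n} ∩ shift^[a] ⁻¹' cylinder ω n := by
      ext x
      simp [and_comm]
    rw [hset, Finset.card_insert_of_notMem ha]
    rcases Q.eq_empty_or_nonempty with rfl | hne
    · simp only [Finset.notMem_empty, IsEmpty.forall_iff, implies_true, Set.ofPred_true,
        Set.univ_inter, Finset.card_empty, zero_add, pow_one]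
      calc P.real (shift^[a] ⁻¹' cylinder ω n) = P.real (cylinder ω n) := real_hit hinv ω n a
        _ ≤ κ * P.real (cylinder ω n) := le_mul_of_one_le_left hp hκ
    · have hge : ∀ q ∈ Q, q + n + g ≤ a := fun q hq =>
        hsep q (Finset.mem_insert_of_mem hq) a (Finset.mem_insert_self a Q) (hlt q hq)
      have hga : g ≤ a := by
        obtain ⟨q, hq⟩ := hne
        have := hge q hq
        omega
      have hE : MeasurableSet[coordSigma 𝒜 (Set.Iio (a - g))]
          {x | ∀ q ∈ Q, shift^[q] x ∈ cylinder ω n} := by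
        have : {x | ∀ q ∈ Q, shift^[q] x ∈ cylinder ω n}
            = ⋂ q ∈ Q, {x | shift^[q] x ∈ cylinder ω n} := by ext; simp
        rw [this]
        refine Finset.measurableSet_biInter _ fun q hq => ?_
        exact measurableSet_coordSigma_hit ω (by have := hge q hq; omega)
      -- The largest time a is split as (a - g) + g: all earlier hits are decided by coordinates
      -- below a - g.
      have := hU (a - g) _ _ hE (measurableSet_cylinder ω n)
      rw [Nat.sub_add_cancel hga] at this
      calc _ ≤ _ := this
        _ ≤ κ * (κ * P.real (cylinder ω n)) ^ Q.card * P.real (cylinder ω n) := by gcongr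
        _ = _ := by ring

variable {l : ℕ} (d : Fin l → ℕ)

/-- The event that `A` is visited at all the times `d_j k`. -/
def returnEvent (A : Set (ℕ → 𝒜)) (k : ℕ) : Set (ℕ → 𝒜) := {x | ∀ j, shift^[d j * k] x ∈ A}

theorem multiReturn_eq_indicator (A : Set (ℕ → 𝒜)) (k : ℕ) (x : ℕ → 𝒜) :
    (multiReturn d A k x : ℝ) = (returnEvent d A k).indicator 1 x := by
  classical
  unfold multiReturn returnEvent
  simp only [Set.indicator_apply, Set.mem_ofPred_eq, Finset.prod_ite_zero, Finset.prod_const_one,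
    Finset.mem_univ, true_imp_iff, Pi.one_apply]
  split_ifs <;> simp

theorem measurableSet_returnEvent (ω : ℕ → 𝒜) (n k : ℕ) :
    MeasurableSet (returnEvent d (cylinder ω n) k) := by
  have : returnEvent d (cylinder ω n) k = ⋂ j, {x | shift^[d j * k] x ∈ cylinder ω n} := by
    ext; simp [returnEvent]
  rw [this]
  exact MeasurableSet.iInter fun j => measurableSet_hit ω n _

theorem real_returnEvent_le_cylinder
    (hinv : MeasurePreserving (shift : (ℕ → 𝒜) → (ℕ → 𝒜)) P P) (hl : 1 ≤ l) (ω : ℕ → 𝒜)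
    (n k : ℕ) : P.real (returnEvent d (cylinder ω n) k) ≤ P.real (cylinder ω n) := by
  rw [← real_hit hinv ω n (d ⟨0, hl⟩ * k)]
  exact measureReal_mono fun x hx => hx _

variable {d}

theorem StrictMono.mul_add_le_mul (hd : StrictMono d) {i j : Fin l} (hij : i < j) (k : ℕ) :
    d i * k + k ≤ d j * k := by
  have : d i + 1 ≤ d j := hd hij
  calc d i * k + k = (d i + 1) * k := by ring
    _ ≤ d j * k := Nat.mul_le_mul_right k this

theorem real_returnEvent_le (hinv : MeasurePreserving (shift : (ℕ → 𝒜) → (ℕ → 𝒜)) P P) {g : ℕ}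
    {κ : ℝ} (hκ : 1 ≤ κ) (hU : UpperMix P g κ) (hd : StrictMono d) (ω : ℕ → 𝒜) {n k : ℕ}
    (hn : 1 ≤ n) (hk : n + g ≤ k) :
    P.real (returnEvent d (cylinder ω n) k) ≤ (κ * P.real (cylinder ω n)) ^ l := by
  classical
  have hinj : Function.Injective fun j => d j * k := fun i j h =>
    hd.injective (Nat.eq_of_mul_eq_mul_right (by omega) h)
  have := real_hits_le hinv hκ hU ω n (Finset.univ.image fun j => d j * k) (by
    simp only [Finset.mem_image, Finset.mem_univ, true_and, forall_exists_index,
      forall_apply_eq_imp_iff]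
    intro i j hij
    have := StrictMono.mul_add_le_mul hd (hd.lt_iff_lt.1 (Nat.lt_of_mul_lt_mul_right hij)) k
    omega)
  rw [Finset.card_image_of_injective _ hinj] at this
  simpa [returnEvent] using this

/-- The visit at time d_e k', with e the last index, comes well after all ℓ visits for k. This one
extra factor p suffices, because it will only have to beat a block length. -/
theorem real_returnEvent_inter_le (hinv : MeasurePreserving (shift : (ℕ → 𝒜) → (ℕ → 𝒜)) P P)
    {g : ℕ} {κ : ℝ} (hκ : 1 ≤ κ) (hU : UpperMix P g κ) (hl : 1 ≤ l) (hd : StrictMono d)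
    (hd1 : ∀ j, 1 ≤ d j) (ω : ℕ → 𝒜) {n k k' : ℕ} (hn : 1 ≤ n) (hk : n + g ≤ k)
    (hkk : k + n + g ≤ k') :
    P.real (returnEvent d (cylinder ω n) k ∩ returnEvent d (cylinder ω n) k')
      ≤ (κ * P.real (cylinder ω n)) ^ (l + 1) := by
  classical
  have hinj : Function.Injective fun j => d j * k := fun i j h =>
    hd.injective (Nat.eq_of_mul_eq_mul_right (by omega) h)
  let e : Fin l := ⟨l - 1, by omega⟩
  have hle : ∀ j, d j * k + n + g ≤ d e * k' := by
    intro j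
    have h1 : d j ≤ d e := hd.monotone (Fin.le_def.2 (by have := j.2; simp only [e]; omega))
    calc d j * k + n + g ≤ d e * k + d e * (n + g) := by
          have := Nat.mul_le_mul_right k h1
          have := Nat.mul_le_mul_right (n + g) (hd1 e)
          omega
      _ = d e * (k + n + g) := by ring
      _ ≤ d e * k' := Nat.mul_le_mul_left _ hkk
  set Q := Finset.univ.image fun j => d j * k with hQ
  have hne : d e * k' ∉ Q := by
    simp only [hQ, Finset.mem_image, Finset.mem_univ, true_and, not_exists]
    intro j hj
    have := hle j
    omega
  have := real_hits_le hinv hκ hU ω n (insert (d e * k') Q) (by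
    simp only [hQ, Finset.mem_insert, Finset.mem_image, Finset.mem_univ, true_and]
    rintro q (rfl | ⟨i, rfl⟩) q' (rfl | ⟨j, rfl⟩) hqq
    · omega
    · have := hle j
      omega
    · exact hle i
    · have := StrictMono.mul_add_le_mul hd (hd.lt_iff_lt.1 (Nat.lt_of_mul_lt_mul_right hqq)) k
      omega)
  rw [Finset.card_insert_of_notMem hne, hQ, Finset.card_image_of_injective _ hinj,
    Finset.card_univ, Fintype.card_fin] at this
  refine le_trans (measureReal_mono ?_) this
  rintro x ⟨hx, hx'⟩ q hq
  simp only [Finset.mem_insert, Finset.mem_image, Finset.mem_univ, true_and] at hq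
  rcases hq with rfl | ⟨j, rfl⟩
  · exact hx' e
  · exact hx j

/-! ### Decay of the measure of cylinders around a periodic point -/

theorem cylinder_anti (ω : ℕ → 𝒜) : Antitone (cylinder ω) :=
  fun _ _ hmn _ hx j hj => hx j (hj.trans_le hmn)

/-- After a multiple of the period, a point that still follows ω follows it from its beginning
again. -/
theorem real_cylinder_add_le {κ : ℝ} {g : ℕ} (hU : UpperMix P g κ) (ω : ℕ → 𝒜) (n j : ℕ)
    (hper : shift^[n + g] ω = ω) :
    P.real (cylinder ω (n + g + j)) ≤ κ * P.real (cylinder ω n) * P.real (cylinder ω j) := by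
  refine le_trans (measureReal_mono ?_) (hU n _ _ (measurableSet_coordSigma_cylinder ω n)
    (measurableSet_cylinder ω j))
  intro x hx
  refine ⟨cylinder_anti ω (by omega) hx, fun i hi => ?_⟩
  rw [shift_iterate_apply, hx _ (by omega), ← shift_iterate_apply (n + g) ω i, hper]

theorem iInter_cylinder (ω : ℕ → 𝒜) : ⋂ n, cylinder ω n = {ω} := by
  ext x
  simp only [Set.mem_iInter, Set.mem_singleton_iff]
  exact ⟨fun h => funext fun j => h (j + 1) j (by omega), fun h n j _ => by rw [h]⟩

theorem tendsto_real_cylinder (P : Measure (ℕ → 𝒜)) [IsProbabilityMeasure P] (ω : ℕ → 𝒜) :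
    Tendsto (fun n => P.real (cylinder ω n)) atTop (𝓝 (P.real {ω})) := by
  rw [← iInter_cylinder ω]
  exact (ENNReal.tendsto_toReal (measure_ne_top _ _)).comp
    (tendsto_measure_iInter_atTop (fun n => (measurableSet_cylinder ω n).nullMeasurableSet)
      (cylinder_anti ω) ⟨0, measure_ne_top _ _⟩)

/-- The limit is P{ω}. If this were positive, then, as ω returns to itself at all multiples of r,
mixing between the n-cylinder and {ω} with gaps tending to infinity gives P{ω} ≤ P(A_n) P{ω}. So
every cylinder has measure one, and P is the point mass at ω. -/
theorem tendsto_real_cylinder_zero {κ : ℕ → ℝ} (hκ : Tendsto κ atTop (𝓝 1))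
    (hU : ∀ g, UpperMix P g (κ g)) (hP : ∀ x : ℕ → 𝒜, P ≠ Measure.dirac x) (ω : ℕ → 𝒜)
    (hper : ω ∈ Function.periodicPts (shift : (ℕ → 𝒜) → (ℕ → 𝒜))) :
    Tendsto (fun n => P.real (cylinder ω n)) atTop (𝓝 0) := by
  obtain ⟨r, hr, hrp⟩ := hper
  have hlim := tendsto_real_cylinder P ω
  suffices h : P.real {ω} = 0 by rwa [h] at hlim
  by_contra hne
  have hpos : 0 < P.real {ω} := lt_of_le_of_ne measureReal_nonneg (Ne.symm hne)
  have hone : ∀ n, P.real (cylinder ω n) = 1 := by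
    intro n
    refine le_antisymm measureReal_le_one ?_
    have hmul : Tendsto (fun i => κ (r * (n + i) - n)) atTop (𝓝 1) := by
      refine hκ.comp (tendsto_atTop_mono (fun i => ?_) tendsto_id)
      have : 1 * (n + i) ≤ r * (n + i) := Nat.mul_le_mul_right _ hr
      simp only [id]
      omega
    have hb : ∀ i, P.real {ω} ≤ κ (r * (n + i) - n) * P.real (cylinder ω n) * P.real {ω} := by
      intro i
      have hle : n ≤ r * (n + i) :=
        le_trans (by omega) (Nat.mul_le_mul_right (n + i) (show 1 ≤ r from hr))
      have hmeas : MeasurableSet ({ω} : Set (ℕ → 𝒜)) := by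
        rw [← iInter_cylinder ω]
        exact MeasurableSet.iInter fun n => measurableSet_cylinder ω n
      refine le_trans (measureReal_mono ?_) (hU _ n _ _ (measurableSet_coordSigma_cylinder ω n)
        hmeas)
      rintro x rfl
      refine ⟨fun j _ => rfl, ?_⟩
      rw [Nat.add_sub_cancel' hle, mul_comm]
      exact (hrp.const_mul (n + i)).eq
    have := ge_of_tendsto' ((hmul.mul_const (P.real (cylinder ω n))).mul_const (P.real {ω})) hb
    rw [one_mul] at this
    exact le_of_mul_le_mul_right (by linarith) hpos
  have h1 : P.real {ω} = 1 := by
    refine tendsto_nhds_unique hlim ?_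
    simp only [hone]
    exact tendsto_const_nhds
  refine hP ω ?_
  have hω : ∀ᵐ x ∂P, x = ω := by
    have hmeas : MeasurableSet ({ω} : Set (ℕ → 𝒜)) := by
      rw [← iInter_cylinder ω]
      exact MeasurableSet.iInter fun n => measurableSet_cylinder ω n
    have : P {ω} = 1 := by
      rw [← ENNReal.toReal_eq_one_iff]
      exact h1
    exact (prob_compl_eq_zero_iff hmeas).2 this
  have hmap : P.map id = P.map fun _ => ω := Measure.map_congr hω
  rw [Measure.map_id, Measure.map_const, measure_univ, one_smul] at hmap
  exact hmap

/-- Lengthening the cylinder by a fixed multiple c of the period at least halves its measure, so the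
decay is geometric and beats n². -/
theorem tendsto_sq_mul_real_cylinder {κ : ℕ → ℝ} (hκ : Tendsto κ atTop (𝓝 1))
    (hU : ∀ g, UpperMix P g (κ g)) (hP : ∀ x : ℕ → 𝒜, P ≠ Measure.dirac x) (ω : ℕ → 𝒜)
    (hper : ω ∈ Function.periodicPts (shift : (ℕ → 𝒜) → (ℕ → 𝒜))) :
    Tendsto (fun n : ℕ => (n : ℝ) ^ 2 * P.real (cylinder ω n)) atTop (𝓝 0) := by
  have h0 := tendsto_real_cylinder_zero hκ hU hP ω hper
  obtain ⟨r, hr, hrp⟩ := hper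
  obtain ⟨a, ha⟩ := (h0.eventually (gt_mem_nhds (show (0 : ℝ) < 1 / 4 by norm_num))).exists
  obtain ⟨G, hG⟩ :=
    (hκ.eventually (gt_mem_nhds (show (1 : ℝ) < 2 by norm_num))).exists_forall_of_atTop
  -- A multiple of the period, long enough for a prefix of length a, of measure below 1/4, followed
  -- by a gap of at least G, where κ < 2: the contraction factor is 2 · 1/4.
  set c := r * (a + G + 1) with hc
  have hcle : a + G + 1 ≤ c :=
    le_trans (by omega) (Nat.mul_le_mul_right (a + G + 1) (show 1 ≤ r from hr))
  have hhalf : ∀ j, P.real (cylinder ω (c + j)) ≤ 1 / 2 * P.real (cylinder ω j) := by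
    intro j
    have hsum : a + (c - a) = c := by omega
    have h1 := real_cylinder_add_le (hU (c - a)) ω a j (by
      rw [hsum, hc, mul_comm]
      exact (hrp.const_mul _).eq)
    rw [hsum] at h1
    refine h1.trans (mul_le_mul_of_nonneg_right ?_ measureReal_nonneg)
    have h2 := hG (c - a) (by omega)
    have h3 : 0 ≤ P.real (cylinder ω a) := measureReal_nonneg
    nlinarith
  have hgeo : ∀ q j, P.real (cylinder ω (c * q + j)) ≤ (1 / 2) ^ q := by
    intro q
    induction q with
    | zero => intro j; simp
    | succ q ih =>
      intro j
      rw [show c * (q + 1) + j = c + (c * q + j) by ring, pow_succ']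
      exact (hhalf _).trans (mul_le_mul_of_nonneg_left (ih j) (by norm_num))
  have hlim : Tendsto (fun q : ℕ => (c : ℝ) ^ 2 * (2 * (((q + 1 : ℕ) : ℝ) ^ 2 * (1 / 2) ^ (q + 1))))
      atTop (𝓝 0) := by
    have := (tendsto_pow_const_mul_const_pow_of_abs_lt_one 2
      (show |(1 / 2 : ℝ)| < 1 by rw [abs_of_pos] <;> norm_num)).comp (tendsto_add_atTop_nat 1)
    simpa [Function.comp_def] using (this.const_mul 2).const_mul ((c : ℝ) ^ 2)
  have hdiv : Tendsto (fun n : ℕ => n / c) atTop atTop := Nat.tendsto_div_const_atTop (by omega)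
  refine squeeze_zero (fun n => by positivity) (fun n => ?_) (hlim.comp hdiv)
  have hn : c * (n / c) + n % c = n := Nat.div_add_mod n c
  have hp := hgeo (n / c) (n % c)
  rw [hn] at hp
  have hnle : (n : ℝ) ≤ c * ((n / c + 1 : ℕ) : ℝ) := by
    have := Nat.mod_lt n (show 0 < c by omega)
    have h' : n ≤ c * (n / c + 1) := by rw [Nat.mul_add]; omega
    exact_mod_cast h'
  calc (n : ℝ) ^ 2 * P.real (cylinder ω n)
      ≤ (c * ((n / c + 1 : ℕ) : ℝ)) ^ 2 * (1 / 2) ^ (n / c) := by gcongr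
    _ = _ := by simp only [Function.comp]; ring

end Bounds

/-! ### Exponential approximation for weakly dependent factors -/

section Abstract

theorem one_sub_prod_le_sum {ι : Type*} (s : Finset ι) (a : ι → ℝ) (h0 : ∀ i, 0 ≤ a i)
    (h1 : ∀ i, a i ≤ 1) : 1 - ∏ i ∈ s, a i ≤ ∑ i ∈ s, (1 - a i) := by
  classical
  induction s using Finset.induction_on with
  | empty => simp
  | insert i s hi ih =>
    rw [Finset.prod_insert hi, Finset.sum_insert hi]
    have hp : ∏ i ∈ s, a i ≤ 1 := Finset.prod_le_one (fun i _ => h0 i) fun i _ => h1 i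
    nlinarith [h0 i, h1 i]

variable {Ω : Type*} [MeasurableSpace Ω] {P : Measure Ω} [IsProbabilityMeasure P]

theorem integrable_of_mem_Icc {u : Ω → ℝ} (hu : Measurable u) (h0 : ∀ x, 0 ≤ u x)
    (h1 : ∀ x, u x ≤ 1) : Integrable u P :=
  Integrable.of_bound hu.aestronglyMeasurable 1
    (ae_of_all _ fun x => by rw [Real.norm_eq_abs, abs_of_nonneg (h0 x)]; exact h1 x)

theorem integral_mem_Icc {u : Ω → ℝ} (hu : Measurable u) (h0 : ∀ x, 0 ≤ u x)
    (h1 : ∀ x, u x ≤ 1) : 0 ≤ ∫ x, u x ∂P ∧ ∫ x, u x ∂P ≤ 1 := by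
  refine ⟨integral_nonneg h0, ?_⟩
  calc ∫ x, u x ∂P ≤ ∫ _, (1 : ℝ) ∂P :=
        integral_mono (integrable_of_mem_Icc hu h0 h1) (integrable_const _) h1
    _ = 1 := by simp

/-- Deleting the factors in s raises the product by at most ∑_{i ∈ s} (1 - f_i). Each deleted factor
costs δ in the mixed integral and η² in the product of integrals; ε is the error for the factors
that remain. -/
theorem abs_integral_prod_mul_sub_le {f : ℕ → Ω → ℝ} (hf : ∀ m, Measurable (f m))
    (h0 : ∀ m x, 0 ≤ f m x) (h1 : ∀ m x, f m x ≤ 1) {m : ℕ} {s : Finset ℕ}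
    (hs : s ⊆ Finset.range m) {ε δ η : ℝ} (hη0 : 0 ≤ η)
    (hε : |∫ x, (∏ i ∈ Finset.range m \ s, f i x) * (1 - f m x) ∂P
      - (∫ x, ∏ i ∈ Finset.range m \ s, f i x ∂P) * ∫ x, (1 - f m x) ∂P| ≤ ε)
    (hδ : ∀ i ∈ s, ∫ x, (1 - f i x) * (1 - f m x) ∂P ≤ δ)
    (hη : ∀ i ∈ s, ∫ x, (1 - f i x) ∂P ≤ η) (hηm : ∫ x, (1 - f m x) ∂P ≤ η) :
    |∫ x, (∏ i ∈ Finset.range m, f i x) * (1 - f m x) ∂P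
      - (∫ x, ∏ i ∈ Finset.range m, f i x ∂P) * ∫ x, (1 - f m x) ∂P|
      ≤ ε + s.card * (δ + η ^ 2) := by
  set F : Ω → ℝ := fun x => ∏ i ∈ Finset.range m, f i x with hF
  set F' : Ω → ℝ := fun x => ∏ i ∈ Finset.range m \ s, f i x with hF'
  have pm : ∀ t : Finset ℕ, Measurable fun x => ∏ i ∈ t, f i x := fun t =>
    Finset.measurable_prod _ fun i _ => hf i
  have p0 : ∀ (t : Finset ℕ) (x : Ω), 0 ≤ ∏ i ∈ t, f i x := fun t x =>
    Finset.prod_nonneg fun i _ => h0 i x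
  have p1 : ∀ (t : Finset ℕ) (x : Ω), ∏ i ∈ t, f i x ≤ 1 := fun t x =>
    Finset.prod_le_one (fun i _ => h0 i x) fun i _ => h1 i x
  have gm : ∀ i, Measurable fun x => 1 - f i x := fun i => measurable_const.sub (hf i)
  have g0 : ∀ i x, 0 ≤ 1 - f i x := fun i x => sub_nonneg.2 (h1 i x)
  have g1 : ∀ i x, 1 - f i x ≤ 1 := fun i x => by linarith [h0 i x]
  have hlow : ∀ x, F x ≤ F' x := by
    intro x
    have : F x = F' x * ∏ i ∈ s, f i x := (Finset.prod_sdiff hs).symm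
    rw [this]
    exact mul_le_of_le_one_right (p0 _ x) (p1 s x)
  have hdiff : ∀ x, F' x - F x ≤ ∑ i ∈ s, (1 - f i x) := by
    intro x
    have : F x = F' x * ∏ i ∈ s, f i x := (Finset.prod_sdiff hs).symm
    have h2 := one_sub_prod_le_sum s (fun i => f i x) (fun i => h0 i x) fun i => h1 i x
    have h3 : F' x - F x = F' x * (1 - ∏ i ∈ s, f i x) := by rw [this]; ring
    rw [h3]
    refine le_trans (mul_le_of_le_one_left (sub_nonneg.2 (p1 s x)) (p1 _ x)) h2
  have iF : Integrable F P := integrable_of_mem_Icc (pm _) (p0 _) (p1 _)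
  have iF' : Integrable F' P := integrable_of_mem_Icc (pm _) (p0 _) (p1 _)
  have ig : ∀ i, Integrable (fun x => 1 - f i x) P := fun i =>
    integrable_of_mem_Icc (gm i) (g0 i) (g1 i)
  have imul : ∀ {u v : Ω → ℝ}, Measurable u → Measurable v → (∀ x, 0 ≤ u x) → (∀ x, u x ≤ 1) →
      (∀ x, 0 ≤ v x) → (∀ x, v x ≤ 1) → Integrable (fun x => u x * v x) P :=
    fun hu hv u0 u1 v0 v1 => integrable_of_mem_Icc (hu.mul hv) (fun x => mul_nonneg (u0 x) (v0 x))
      fun x => mul_le_one₀ (u1 x) (v0 x) (v1 x)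
  have iFg : Integrable (fun x => F x * (1 - f m x)) P :=
    imul (pm _) (gm m) (p0 _) (p1 _) (g0 m) (g1 m)
  have iFg' : Integrable (fun x => F' x * (1 - f m x)) P :=
    imul (pm _) (gm m) (p0 _) (p1 _) (g0 m) (g1 m)
  have igg : ∀ i, Integrable (fun x => (1 - f i x) * (1 - f m x)) P := fun i =>
    imul (gm i) (gm m) (g0 i) (g1 i) (g0 m) (g1 m)
  have e1 : ∫ x, F' x * (1 - f m x) ∂P - ∫ x, F x * (1 - f m x) ∂P ≤ s.card * δ := by
    rw [← integral_sub iFg' iFg]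
    calc ∫ x, (F' x * (1 - f m x) - F x * (1 - f m x)) ∂P
        ≤ ∫ x, ∑ i ∈ s, (1 - f i x) * (1 - f m x) ∂P := by
          refine integral_mono (iFg'.sub iFg) (integrable_finsetSum _ fun i _ => igg i) fun x => ?_
          simp only
          rw [← sub_mul, ← Finset.sum_mul]
          exact mul_le_mul_of_nonneg_right (hdiff x) (g0 m x)
      _ = ∑ i ∈ s, ∫ x, (1 - f i x) * (1 - f m x) ∂P := integral_finsetSum _ fun i _ => igg i
      _ ≤ ∑ _i ∈ s, δ := Finset.sum_le_sum hδ
      _ = s.card * δ := by simp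
  have e1' : 0 ≤ ∫ x, F' x * (1 - f m x) ∂P - ∫ x, F x * (1 - f m x) ∂P := by
    rw [← integral_sub iFg' iFg]
    refine integral_nonneg fun x => ?_
    simp only [Pi.zero_apply]
    rw [← sub_mul]
    exact mul_nonneg (sub_nonneg.2 (hlow x)) (g0 m x)
  have e2 : ∫ x, F' x ∂P - ∫ x, F x ∂P ≤ s.card * η := by
    rw [← integral_sub iF' iF]
    calc ∫ x, (F' x - F x) ∂P ≤ ∫ x, ∑ i ∈ s, (1 - f i x) ∂P :=
          integral_mono (iF'.sub iF) (integrable_finsetSum _ fun i _ => ig i) hdiff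
      _ = ∑ i ∈ s, ∫ x, (1 - f i x) ∂P := integral_finsetSum _ fun i _ => ig i
      _ ≤ ∑ _i ∈ s, η := Finset.sum_le_sum hη
      _ = s.card * η := by simp
  have e2' : 0 ≤ ∫ x, F' x ∂P - ∫ x, F x ∂P := by
    rw [← integral_sub iF' iF]
    exact integral_nonneg fun x => sub_nonneg.2 (hlow x)
  have hg0 : 0 ≤ ∫ x, (1 - f m x) ∂P := integral_nonneg (g0 m)
  have e3 : (∫ x, F' x ∂P - ∫ x, F x ∂P) * ∫ x, (1 - f m x) ∂P ≤ s.card * η * η :=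
    mul_le_mul e2 hηm hg0 (by positivity)
  have e3' : 0 ≤ (∫ x, F' x ∂P - ∫ x, F x ∂P) * ∫ x, (1 - f m x) ∂P := mul_nonneg e2' hg0
  have hb : (0 : ℝ) ≤ s.card * η * η := by positivity
  have ha : 0 ≤ s.card * δ := e1'.trans e1
  rw [abs_le] at hε ⊢
  rw [sub_mul] at e3 e3'
  constructor <;> nlinarith [hε.1, hε.2]

/-- Poisson-type approximation for products of weakly dependent factors close to one. -/
theorem abs_integral_prod_sub_exp_le {f : ℕ → Ω → ℝ} (hf : ∀ m, Measurable (f m))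
    (h0 : ∀ m x, 0 ≤ f m x) (h1 : ∀ m x, f m x ≤ 1) {near : ℕ → Finset ℕ}
    (hs : ∀ m, near m ⊆ Finset.range m) {ε δ η c : ℝ} (hη0 : 0 ≤ η) (hη1 : η ≤ 1) (hδ0 : 0 ≤ δ)
    (hc : ∀ m, ((near m).card : ℝ) ≤ c)
    (hε : ∀ m, |∫ x, (∏ i ∈ Finset.range m \ near m, f i x) * (1 - f m x) ∂P
      - (∫ x, ∏ i ∈ Finset.range m \ near m, f i x ∂P) * ∫ x, (1 - f m x) ∂P| ≤ ε)
    (hδ : ∀ m, ∀ i < m, ∫ x, (1 - f i x) * (1 - f m x) ∂P ≤ δ)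
    (hη : ∀ m, ∫ x, (1 - f m x) ∂P ≤ η) (M : ℕ) :
    |∫ x, ∏ m ∈ Finset.range M, f m x ∂P
      - Real.exp (-∑ m ∈ Finset.range M, ∫ x, (1 - f m x) ∂P)|
      ≤ M * (ε + c * (δ + η ^ 2) + η ^ 2) := by
  induction M with
  | zero => simp
  | succ m ih =>
    set X := ∫ x, (1 - f m x) ∂P with hX
    set Φ := ∫ x, ∏ i ∈ Finset.range m, f i x ∂P with hΦ
    have pm : Measurable fun x => ∏ i ∈ Finset.range m, f i x :=
      Finset.measurable_prod _ fun i _ => hf i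
    have p0 : ∀ x : Ω, 0 ≤ ∏ i ∈ Finset.range m, f i x := fun x =>
      Finset.prod_nonneg fun i _ => h0 i x
    have p1 : ∀ x : Ω, ∏ i ∈ Finset.range m, f i x ≤ 1 := fun x =>
      Finset.prod_le_one (fun i _ => h0 i x) fun i _ => h1 i x
    have hX0 : 0 ≤ X := integral_nonneg fun x => sub_nonneg.2 (h1 m x)
    have hΦ1 := integral_mem_Icc (P := P) pm p0 p1
    have hstep := abs_integral_prod_mul_sub_le hf h0 h1 (hs m) hη0 (hε m)
      (fun i hi => hδ m i (Finset.mem_range.1 (hs m hi))) (fun i _ => hη i) (hη m)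
    have hcard : ((near m).card : ℝ) * (δ + η ^ 2) ≤ c * (δ + η ^ 2) :=
      mul_le_mul_of_nonneg_right (hc m) (by positivity)
    have hsucc : ∫ x, ∏ i ∈ Finset.range (m + 1), f i x ∂P
        = Φ - ∫ x, (∏ i ∈ Finset.range m, f i x) * (1 - f m x) ∂P := by
      rw [hΦ, ← integral_sub (integrable_of_mem_Icc pm p0 p1)]
      · refine integral_congr_ae (ae_of_all _ fun x => ?_)
        simp only [Finset.prod_range_succ]
        ring
      · exact integrable_of_mem_Icc (pm.mul (measurable_const.sub (hf m)))
          (fun x => mul_nonneg (p0 x) (sub_nonneg.2 (h1 m x)))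
          fun x => mul_le_one₀ (p1 x) (sub_nonneg.2 (h1 m x)) (by linarith [h0 m x])
    rw [hsucc, Finset.sum_range_succ, neg_add, Real.exp_add, ← hX]
    set G := ∫ x, (∏ i ∈ Finset.range m, f i x) * (1 - f m x) ∂P
    set E := Real.exp (-∑ m ∈ Finset.range m, ∫ x, (1 - f m x) ∂P)
    have hq : |Real.exp (-X) - 1 - -X| ≤ (-X) ^ 2 :=
      Real.abs_exp_sub_one_sub_id_le (by rw [abs_neg, abs_of_nonneg hX0]; exact (hη m).trans hη1)
    have hXη : X ^ 2 ≤ η ^ 2 := pow_le_pow_left₀ hX0 (hη m) 2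
    have hex0 : 0 ≤ Real.exp (-X) := (Real.exp_pos _).le
    have hex1 : Real.exp (-X) ≤ 1 := Real.exp_le_one_iff.2 (by linarith)
    have t1 : |Φ * (1 - X - Real.exp (-X))| ≤ η ^ 2 := by
      rw [abs_mul, abs_of_nonneg hΦ1.1]
      have : |1 - X - Real.exp (-X)| ≤ η ^ 2 := by
        rw [abs_sub_comm]
        have h2 : Real.exp (-X) - (1 - X) = Real.exp (-X) - 1 - -X := by ring
        rw [h2]
        exact hq.trans (by rw [neg_sq]; exact hXη)
      exact (mul_le_of_le_one_left (abs_nonneg _) hΦ1.2).trans this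
    have t2 : |(Φ - E) * Real.exp (-X)| ≤ |Φ - E| := by
      rw [abs_mul, abs_of_nonneg hex0]
      exact mul_le_of_le_one_right (abs_nonneg _) hex1
    -- Three errors: dependence of the new factor on the earlier ones, replacing 1 - X by exp(-X),
    -- and the inherited error, which is not amplified.
    have hdec : Φ - G - E * Real.exp (-X)
        = -(G - Φ * X) + Φ * (1 - X - Real.exp (-X)) + (Φ - E) * Real.exp (-X) := by ring
    rw [hdec]
    refine (abs_add_three _ _ _).trans ?_
    rw [abs_neg]
    push_cast
    linarith

end Abstract

/-! ### Cutting a union of windows away from a distant set -/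

/-- The windows are peeled off from the right, with two cuts for each: one at its right end, and one
at distance g before its left end with the roles of the two sets exchanged. -/
theorem interlaced_iUnion_Ico {g L l : ℕ} (s : Fin l → ℕ) (hs : ∀ i j, i < j → s i + L + g ≤ s j)
    (hg : ∀ i, g ≤ s i) (V : Set ℕ) (hV : ∀ j ∈ V, ∀ i, j + g < s i ∨ s i + L + g ≤ j) :
    Interlaced g (2 * l) (⋃ i, Set.Ico (s i) (s i + L)) V := by
  induction l generalizing V with
  | zero =>
    rw [Set.iUnion_of_empty]
    exact Interlaced.empty V
  | succ l ih =>
    have hlast : ∀ i : Fin l, s i.castSucc + L + g ≤ s (Fin.last l) := fun i =>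
      hs _ _ (Fin.castSucc_lt_last i)
    have hgl := hg (Fin.last l)
    have hU : (⋃ i, Set.Ico (s i) (s i + L)) ∩ Set.Iio (s (Fin.last l) - g)
        = ⋃ i : Fin l, Set.Ico (s i.castSucc) (s i.castSucc + L) := by
      ext j
      simp only [Set.mem_inter_iff, Set.mem_iUnion, Set.mem_Ico, Set.mem_Iio]
      constructor
      · rintro ⟨⟨i, hi⟩, hj⟩
        induction i using Fin.lastCases with
        | last => omega
        | cast i => exact ⟨i, hi⟩
      · rintro ⟨i, hi⟩
        have := hlast i
        exact ⟨⟨i.castSucc, hi⟩, by omega⟩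
    refine Interlaced.cut (s (Fin.last l) + L) ?_ ?_ ?_
    · rintro j hj
      obtain ⟨i, hi⟩ := Set.mem_iUnion.1 hj
      rw [Set.mem_Ico] at hi
      induction i using Fin.lastCases with
      | last => omega
      | cast i => have := hlast i; omega
    · intro j hj
      have := hV j hj (Fin.last l)
      omega
    · refine Interlaced.symm (Interlaced.cut (s (Fin.last l) - g) ?_ ?_ ?_)
      · rintro j ⟨hj, hj'⟩
        have := hV j hj (Fin.last l)
        rw [Set.mem_Iio] at hj'
        omega
      · intro j hj
        obtain ⟨i, hi⟩ := Set.mem_iUnion.1 hj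
        rw [Set.mem_Ico] at hi
        induction i using Fin.lastCases with
        | last => omega
        | cast i => have := hlast i; omega
      · rw [hU]
        exact Interlaced.symm (ih (fun i => s i.castSucc)
          (fun i j hij => hs _ _ (Fin.castSucc_lt_castSucc_iff.2 hij)) (fun i => hg _) _
          fun j hj i => hV j hj.1 _)

/-! ### Return counts and their moments -/

section Blocks

variable {𝒜 : Type*} [Countable 𝒜] [MeasurableSpace 𝒜] [DiscreteMeasurableSpace 𝒜]
  {P : Measure (ℕ → 𝒜)} [IsProbabilityMeasure P]

/-- The error is relative to ∫ u, not merely to the bound 1. This is what survives summation over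
all blocks, since the first moments of the blocks have a bounded sum. -/
theorem Interlaced.abs_integral_mul_sub_le
    (hinv : MeasurePreserving (shift : (ℕ → 𝒜) → (ℕ → 𝒜)) P P)
    {g : ℕ} {κ : ℝ} (hκ : 1 ≤ κ) (hQ : QuasiIndep P g (ENNReal.ofReal κ)) {K : ℕ} {U V : Set ℕ}
    (hUV : Interlaced g K U V) {u v : (ℕ → 𝒜) → ℝ} (hu : Measurable u) (hv : Measurable v)
    (hud : DependsOn u U) (hvd : DependsOn v V) (hu0 : ∀ x, 0 ≤ u x) (hu1 : ∀ x, u x ≤ 1)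
    (hv0 : ∀ x, 0 ≤ v x) (hv1 : ∀ x, v x ≤ 1) :
    |∫ x, v x * u x ∂P - (∫ x, v x ∂P) * ∫ x, u x ∂P| ≤ (κ ^ (2 * K) - 1) * ∫ x, u x ∂P := by
  have hκ0 : 0 ≤ κ := by linarith
  have hk : 1 ≤ κ ^ (2 * K) := one_le_pow₀ hκ
  obtain ⟨h1, h2⟩ := hUV.lintegral_mul hinv hQ (fun x => ENNReal.ofReal (u x))
    (fun x => ENNReal.ofReal (v x)) hu.ennreal_ofReal hv.ennreal_ofReal
    (fun x y hxy => congrArg ENNReal.ofReal (hud hxy))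
    (fun x y hxy => congrArg ENNReal.ofReal (hvd hxy))
  have iu := integrable_of_mem_Icc (P := P) hu hu0 hu1
  have iv := integrable_of_mem_Icc (P := P) hv hv0 hv1
  have iuv : Integrable (fun x => u x * v x) P := integrable_of_mem_Icc (hu.mul hv)
    (fun x => mul_nonneg (hu0 x) (hv0 x)) fun x => mul_le_one₀ (hu1 x) (hv0 x) (hv1 x)
  have huv0 : ∀ x, 0 ≤ u x * v x := fun x => mul_nonneg (hu0 x) (hv0 x)
  have e : ∀ x, ENNReal.ofReal (u x) * ENNReal.ofReal (v x) = ENNReal.ofReal (u x * v x) :=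
    fun x => (ENNReal.ofReal_mul (hu0 x)).symm
  simp only [e] at h1 h2
  rw [← ofReal_integral_eq_lintegral_ofReal iu (ae_of_all _ hu0),
    ← ofReal_integral_eq_lintegral_ofReal iv (ae_of_all _ hv0),
    ← ofReal_integral_eq_lintegral_ofReal iuv (ae_of_all _ huv0),
    ← ENNReal.ofReal_pow hκ0, ← ENNReal.ofReal_mul (integral_nonneg hu0),
    ← ENNReal.ofReal_mul (by positivity)] at h1 h2
  obtain ⟨u0, u1⟩ := integral_mem_Icc (P := P) hu hu0 hu1
  obtain ⟨v0, v1⟩ := integral_mem_Icc (P := P) hv hv0 hv1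
  have uv0 : 0 ≤ ∫ x, u x * v x ∂P := integral_nonneg huv0
  rw [ENNReal.ofReal_le_ofReal_iff (by positivity)] at h1 h2
  have huvle : ∫ x, u x * v x ∂P ≤ ∫ x, u x ∂P :=
    integral_mono iuv iu fun x => mul_le_of_le_one_right (hu0 x) (hv1 x)
  have hprod : (∫ x, u x ∂P) * ∫ x, v x ∂P ≤ ∫ x, u x ∂P := mul_le_of_le_one_right u0 v1
  simp only [mul_comm (v _)]
  rw [mul_comm (∫ x, v x ∂P), abs_le]
  have hk' : 0 ≤ κ ^ (2 * K) - 1 := by linarith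
  constructor
  · have := mul_le_mul_of_nonneg_left huvle hk'
    linarith
  · have := mul_le_mul_of_nonneg_left hprod hk'
    linarith

variable {l : ℕ} (d : Fin l → ℕ)

/-- The number of multiple returns to `A` at times in `s`. -/
noncomputable def countOn (A : Set (ℕ → 𝒜)) (s : Finset ℕ) (x : ℕ → 𝒜) : ℕ :=
  ∑ k ∈ s, multiReturn d A k x

theorem returnCount_eq_countOn (A : Set (ℕ → 𝒜)) (N : ℕ) :
    returnCount d A N = countOn d A (Finset.Icc 1 N) := rfl

theorem measurable_countOn (ω : ℕ → 𝒜) (n : ℕ) (s : Finset ℕ) :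
    Measurable (countOn d (cylinder ω n) s) := by
  unfold countOn multiReturn
  refine Finset.measurable_sum _ fun k _ => Finset.measurable_prod _ fun j _ => ?_
  exact (measurable_const.indicator (measurableSet_cylinder ω n)).comp (measurable_shift.iterate _)

theorem cast_countOn (A : Set (ℕ → 𝒜)) (s : Finset ℕ) (x : ℕ → 𝒜) :
    (countOn d A s x : ℝ) = ∑ k ∈ s, (returnEvent d A k).indicator 1 x := by
  simp only [countOn, Nat.cast_sum, multiReturn_eq_indicator]

theorem integrable_indicator_one {E : Set (ℕ → 𝒜)} (hE : MeasurableSet E) :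
    Integrable (E.indicator (1 : (ℕ → 𝒜) → ℝ)) P :=
  (integrable_const (1 : ℝ)).indicator hE

theorem integrable_countOn (ω : ℕ → 𝒜) (n : ℕ) (s : Finset ℕ) :
    Integrable (fun x => (countOn d (cylinder ω n) s x : ℝ)) P := by
  simp only [cast_countOn]
  exact integrable_finsetSum _ fun k _ =>
    integrable_indicator_one (measurableSet_returnEvent d ω n k)

theorem integral_countOn (ω : ℕ → 𝒜) (n : ℕ) (s : Finset ℕ) :
    ∫ x, (countOn d (cylinder ω n) s x : ℝ) ∂P
      = ∑ k ∈ s, P.real (returnEvent d (cylinder ω n) k) := by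
  simp only [cast_countOn]
  rw [integral_finsetSum _ fun k _ =>
    integrable_indicator_one (measurableSet_returnEvent d ω n k)]
  exact Finset.sum_congr rfl fun k _ => integral_indicator_one (measurableSet_returnEvent d ω n k)

theorem countOn_mul_countOn (A : Set (ℕ → 𝒜)) (s s' : Finset ℕ) (x : ℕ → 𝒜) :
    (countOn d A s x : ℝ) * countOn d A s' x
      = ∑ k ∈ s, ∑ k' ∈ s', (returnEvent d A k ∩ returnEvent d A k').indicator 1 x := by
  rw [cast_countOn, cast_countOn, Finset.sum_mul_sum]
  refine Finset.sum_congr rfl fun k _ => Finset.sum_congr rfl fun k' _ => ?_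
  rw [Set.inter_indicator_one, Pi.mul_apply]

theorem integrable_countOn_mul (ω : ℕ → 𝒜) (n : ℕ) (s s' : Finset ℕ) :
    Integrable (fun x => (countOn d (cylinder ω n) s x : ℝ) * countOn d (cylinder ω n) s' x) P := by
  simp only [countOn_mul_countOn]
  exact integrable_finsetSum _ fun k _ => integrable_finsetSum _ fun k' _ =>
    integrable_indicator_one
      ((measurableSet_returnEvent d ω n k).inter (measurableSet_returnEvent d ω n k'))

theorem integral_countOn_mul (ω : ℕ → 𝒜) (n : ℕ) (s s' : Finset ℕ) :
    ∫ x, (countOn d (cylinder ω n) s x : ℝ) * countOn d (cylinder ω n) s' x ∂P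
      = ∑ k ∈ s, ∑ k' ∈ s',
        P.real (returnEvent d (cylinder ω n) k ∩ returnEvent d (cylinder ω n) k') := by
  have hm : ∀ k k', MeasurableSet
      (returnEvent d (cylinder ω n) k ∩ returnEvent d (cylinder ω n) k') := fun k k' =>
    (measurableSet_returnEvent d ω n k).inter (measurableSet_returnEvent d ω n k')
  simp only [countOn_mul_countOn]
  rw [integral_finsetSum _ fun k _ => integrable_finsetSum _ fun k' _ =>
    integrable_indicator_one (hm k k')]
  refine Finset.sum_congr rfl fun k _ => ?_
  rw [integral_finsetSum _ fun k' _ => integrable_indicator_one (hm k k')]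
  exact Finset.sum_congr rfl fun k' _ => integral_indicator_one (hm k k')

theorem dependsOn_countOn (ω : ℕ → 𝒜) (n : ℕ) (s : Finset ℕ) {U : Set ℕ}
    (hU : ∀ k ∈ s, ∀ a, ∀ i < n, d a * k + i ∈ U) :
    DependsOn (countOn d (cylinder ω n) s) U := by
  intro x y hxy
  refine Finset.sum_congr rfl fun k hk => Finset.prod_congr rfl fun a _ => ?_
  have : shift^[d a * k] x ∈ cylinder ω n ↔ shift^[d a * k] y ∈ cylinder ω n := by
    refine forall₂_congr fun i hi => ?_
    rw [shift_iterate_apply, shift_iterate_apply, hxy _ (hU k hk a i hi)]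
  by_cases h : shift^[d a * k] x ∈ cylinder ω n
  · rw [Set.indicator_of_mem h, Set.indicator_of_mem (this.1 h)]
  · rw [Set.indicator_of_notMem h, Set.indicator_of_notMem (fun h' => h (this.2 h'))]

theorem one_sub_pow_le {z : ℝ} (hz0 : 0 ≤ z) (w : ℕ) : 1 - z ^ w ≤ w * (1 - z) := by
  have := one_add_mul_le_pow (show -2 ≤ z - 1 by linarith) w
  rw [show 1 + (z - 1) = z by ring] at this
  linarith

/-- The earlier blocks `i < m` which share nearby coordinates with the block `m`. -/
noncomputable def nearBlocks (m₀ m : ℕ) : Finset ℕ :=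
  (Finset.range m).filter fun i => ∃ a b, d a * (m₀ + i) ≤ d b * (m₀ + m) + ∑ j, d j ∧
    d b * (m₀ + m) ≤ d a * (m₀ + i) + ∑ j, d j

/-- For each of the ℓ² pairs (a, b), the map i ↦ d_a (m₀ + i) is injective and sends the near blocks
into an interval with at most 2D + 1 integers, D = ∑ d_j. -/
theorem card_nearBlocks_le (hd1 : ∀ j, 1 ≤ d j) (m₀ m : ℕ) :
    (nearBlocks d m₀ m).card ≤ l * l * (2 * ∑ j, d j + 1) := by
  classical
  set D := ∑ j, d j with hD
  let S : Fin l × Fin l → Finset ℕ := fun q => (Finset.range m).filter fun i =>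
    d q.1 * (m₀ + i) ≤ d q.2 * (m₀ + m) + D ∧ d q.2 * (m₀ + m) ≤ d q.1 * (m₀ + i) + D
  have hsub : nearBlocks d m₀ m ⊆ Finset.univ.biUnion S := by
    intro i hi
    simp only [nearBlocks, Finset.mem_filter] at hi
    obtain ⟨him, a, b, hab⟩ := hi
    exact Finset.mem_biUnion.2 ⟨(a, b), Finset.mem_univ _, Finset.mem_filter.2 ⟨him, hab⟩⟩
  have hS : ∀ q ∈ (Finset.univ : Finset (Fin l × Fin l)), (S q).card ≤ 2 * D + 1 := by
    intro q _
    have hmaps : Set.MapsTo (fun i => d q.1 * (m₀ + i)) (S q)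
        (Finset.Icc (d q.2 * (m₀ + m) - D) (d q.2 * (m₀ + m) + D)) := by
      intro i hi
      have := (Finset.mem_filter.1 hi).2
      simp only [Finset.coe_Icc, Set.mem_Icc]
      omega
    have hinj : Set.InjOn (fun i => d q.1 * (m₀ + i)) (S q) := by
      intro i _ i' _ h
      have := Nat.eq_of_mul_eq_mul_left (hd1 q.1) h
      omega
    have := Finset.card_le_card_of_injOn _ hmaps hinj
    rw [Nat.card_Icc] at this
    omega
  refine (Finset.card_le_card hsub).trans ((Finset.card_biUnion_le_card_mul _ _ _ hS).trans ?_)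
  simp

/-- The `i`-th block of times, of length `b - 2 n`. -/
def block (m₀ b n i : ℕ) : Finset ℕ :=
  Finset.Ico ((m₀ + i) * b) ((m₀ + i) * b + (b - 2 * n))

theorem card_block_le (m₀ b n i : ℕ) : (block m₀ b n i).card ≤ b := by
  simp [block]

end Blocks

/-! ### Block decomposition of the generating function -/

section Approximation

variable {𝒜 : Type*} [Countable 𝒜] [MeasurableSpace 𝒜] [DiscreteMeasurableSpace 𝒜]
  {P : Measure (ℕ → 𝒜)} [IsProbabilityMeasure P] {l : ℕ} {d : Fin l → ℕ}

/-- The coordinates on which the returns in the `i`-th block depend. -/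
def blockCoords (d : Fin l → ℕ) (m₀ b i : ℕ) : Set ℕ :=
  ⋃ a, Set.Ico (d a * ((m₀ + i) * b)) (d a * ((m₀ + i) * b) + (∑ j, d j) * b)

theorem mem_blockCoords (hd1 : ∀ j, 1 ≤ d j) {m₀ b n i k : ℕ} (hb : 2 * n ≤ b)
    (hk : k ∈ block m₀ b n i) (a : Fin l) {j : ℕ} (hj : j < n) :
    d a * k + j ∈ blockCoords d m₀ b i := by
  rw [block, Finset.mem_Ico] at hk
  refine Set.mem_iUnion.2 ⟨a, ?_, ?_⟩
  · have := Nat.mul_le_mul_left (d a) hk.1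
    omega
  · have h1 : d a * (k + 2 * n) ≤ d a * ((m₀ + i) * b + b) := Nat.mul_le_mul_left _ (by omega)
    have h2 : d a * b ≤ (∑ j, d j) * b :=
      Nat.mul_le_mul_right _ (Finset.single_le_sum (fun _ _ => Nat.zero_le _) (Finset.mem_univ a))
    have h3 : 1 * n ≤ d a * n := Nat.mul_le_mul_right _ (hd1 a)
    have h4 : d a * (k + 2 * n) = d a * k + 2 * (d a * n) := by ring
    have h5 : d a * ((m₀ + i) * b + b) = d a * ((m₀ + i) * b) + d a * b := by ring
    omega

theorem dependsOn_countOn_block (hd1 : ∀ j, 1 ≤ d j) (ω : ℕ → 𝒜) {m₀ b n i : ℕ}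
    (hb : 2 * n ≤ b) :
    DependsOn (countOn d (cylinder ω n) (block m₀ b n i)) (blockCoords d m₀ b i) :=
  dependsOn_countOn d ω n _ fun _ hk a _ hj => mem_blockCoords hd1 hb hk a hj

/-- Skipping the first m₀ ≥ D + 2 block positions, with D = ∑ d_j, places the ℓ windows of a block
at least (D + 2) b apart, while each has length D b. A window of a block that is not near starts at
least (D + 1) b away. Either way a spare b ≥ 2n remains for the gap. -/
theorem interlaced_blockCoords (hd : StrictMono d) (hd1 : ∀ j, 1 ≤ d j) {m₀ b n m : ℕ}
    (hb : 2 * n ≤ b) (hm₀ : ∑ j, d j + 2 ≤ m₀) :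
    Interlaced n (2 * l) (blockCoords d m₀ b m)
      (⋃ i ∈ Finset.range m \ nearBlocks d m₀ m, blockCoords d m₀ b i) := by
  refine interlaced_iUnion_Ico _ (fun i j hij => ?_) (fun i => ?_) _ fun j hj a => ?_
  · have h1 := StrictMono.mul_add_le_mul hd hij ((m₀ + m) * b)
    have h2 : (∑ j, d j + 2) * b ≤ (m₀ + m) * b := Nat.mul_le_mul_right _ (by omega)
    have h3 : (∑ j, d j + 2) * b = (∑ j, d j) * b + 2 * b := by ring
    omega
  · have h1 : 1 * (1 * b) ≤ d i * ((m₀ + m) * b) :=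
      Nat.mul_le_mul (hd1 i) (Nat.mul_le_mul_right _ (by omega))
    omega
  · simp only [Set.mem_iUnion, Finset.mem_sdiff, Finset.mem_range] at hj
    obtain ⟨i, ⟨him, hnear⟩, hj⟩ := hj
    obtain ⟨c, hc⟩ := Set.mem_iUnion.1 hj
    rw [Set.mem_Ico] at hc
    have hfar : d c * (m₀ + i) + ∑ j, d j + 1 ≤ d a * (m₀ + m) ∨
        d a * (m₀ + m) + ∑ j, d j + 1 ≤ d c * (m₀ + i) := by
      by_contra hcon
      refine hnear (Finset.mem_filter.2 ⟨Finset.mem_range.2 him, c, a, ?_⟩)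
      omega
    have e1 : d c * ((m₀ + i) * b) = d c * (m₀ + i) * b := by ring
    have e2 : d a * ((m₀ + m) * b) = d a * (m₀ + m) * b := by ring
    rw [e1] at hc
    rw [e2]
    rcases hfar with h | h
    · left
      have h1 := Nat.mul_le_mul_right b h
      have h2 : (d c * (m₀ + i) + ∑ j, d j + 1) * b
        = d c * (m₀ + i) * b + (∑ j, d j) * b + b := by ring
      omega
    · right
      have h1 := Nat.mul_le_mul_right b h
      have h2 : (d a * (m₀ + m) + ∑ j, d j + 1) * b
        = d a * (m₀ + m) * b + (∑ j, d j) * b + b := by ring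
      omega

theorem block_gap {m₀ b n i m k k' : ℕ} (hb : 2 * n ≤ b) (him : i < m)
    (hk : k ∈ block m₀ b n i) (hk' : k' ∈ block m₀ b n m) : k + n + n ≤ k' := by
  rw [block, Finset.mem_Ico] at hk hk'
  have h1 : (m₀ + i + 1) * b ≤ (m₀ + m) * b := Nat.mul_le_mul_right _ (by omega)
  have h2 : (m₀ + i + 1) * b = (m₀ + i) * b + b := by ring
  omega

theorem le_of_mem_block {m₀ b n i k : ℕ} (hb : 2 * n ≤ b) (hm₀ : 1 ≤ m₀)
    (hk : k ∈ block m₀ b n i) : n + n ≤ k := by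
  rw [block, Finset.mem_Ico] at hk
  have h1 : 1 * b ≤ (m₀ + i) * b := Nat.mul_le_mul_right _ (by omega)
  omega

theorem integral_countOn_block_le (hinv : MeasurePreserving (shift : (ℕ → 𝒜) → (ℕ → 𝒜)) P P)
    {κ : ℝ} (hκ : 1 ≤ κ) (hd : StrictMono d) (ω : ℕ → 𝒜) {m₀ b n : ℕ} (hn : 1 ≤ n)
    (hU : UpperMix P n κ) (hb : 2 * n ≤ b) (hm₀ : 1 ≤ m₀) (i : ℕ) :
    ∫ x, (countOn d (cylinder ω n) (block m₀ b n i) x : ℝ) ∂P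
      ≤ b * (κ * P.real (cylinder ω n)) ^ l := by
  rw [integral_countOn]
  have hp : 0 ≤ (κ * P.real (cylinder ω n)) ^ l :=
    pow_nonneg (mul_nonneg (by linarith) measureReal_nonneg) _
  calc _ ≤ ∑ _k ∈ block m₀ b n i, (κ * P.real (cylinder ω n)) ^ l :=
        Finset.sum_le_sum fun k hk =>
          real_returnEvent_le hinv hκ hU hd ω hn (le_of_mem_block hb hm₀ hk)
    _ = (block m₀ b n i).card * (κ * P.real (cylinder ω n)) ^ l := by simp
    _ ≤ _ := mul_le_mul_of_nonneg_right (by exact_mod_cast card_block_le _ _ _ _) hp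

theorem integral_countOn_block_mul_le
    (hinv : MeasurePreserving (shift : (ℕ → 𝒜) → (ℕ → 𝒜)) P P)
    {κ : ℝ} (hκ : 1 ≤ κ) (hl : 1 ≤ l) (hd : StrictMono d) (hd1 : ∀ j, 1 ≤ d j) (ω : ℕ → 𝒜)
    {m₀ b n : ℕ} (hn : 1 ≤ n) (hU : UpperMix P n κ) (hb : 2 * n ≤ b) (hm₀ : 1 ≤ m₀) {i m : ℕ}
    (him : i < m) :
    ∫ x, (countOn d (cylinder ω n) (block m₀ b n i) x : ℝ)
        * countOn d (cylinder ω n) (block m₀ b n m) x ∂P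
      ≤ (b : ℝ) ^ 2 * (κ * P.real (cylinder ω n)) ^ (l + 1) := by
  rw [integral_countOn_mul]
  have hp : 0 ≤ (κ * P.real (cylinder ω n)) ^ (l + 1) :=
    pow_nonneg (mul_nonneg (by linarith) measureReal_nonneg) _
  calc _ ≤ ∑ _k ∈ block m₀ b n i, ∑ _k' ∈ block m₀ b n m, (κ * P.real (cylinder ω n)) ^ (l + 1) :=
        Finset.sum_le_sum fun k hk => Finset.sum_le_sum fun k' hk' =>
          real_returnEvent_inter_le hinv hκ hU hl hd hd1 ω hn (le_of_mem_block hb hm₀ hk)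
            (block_gap hb him hk hk')
    _ = (block m₀ b n i).card * ((block m₀ b n m).card * (κ * P.real (cylinder ω n)) ^ (l + 1)) := by
        simp
    _ ≤ b * (b * (κ * P.real (cylinder ω n)) ^ (l + 1)) := by
        gcongr <;> exact card_block_le _ _ _ _
    _ = _ := by ring

/-- The abstract estimate applied to f_i = z^{W_i}. As 1 - z^W ≤ W, first and mixed moments of the
counts bound η and δ. -/
theorem abs_integral_prod_block_sub_exp_le
    (hinv : MeasurePreserving (shift : (ℕ → 𝒜) → (ℕ → 𝒜)) P P)
    {κ : ℝ} (hκ : 1 ≤ κ) (hl : 1 ≤ l) (hd : StrictMono d) (hd1 : ∀ j, 1 ≤ d j) (ω : ℕ → 𝒜)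
    {m₀ b n : ℕ} (hn : 1 ≤ n) (hU : UpperMix P n κ) (hQ : QuasiIndep P n (ENNReal.ofReal κ))
    (hb : 2 * n ≤ b) (hm₀ : ∑ j, d j + 2 ≤ m₀) {z : ℝ} (hz0 : 0 ≤ z) (hz1 : z ≤ 1)
    (hη1 : b * (κ * P.real (cylinder ω n)) ^ l ≤ 1) (M : ℕ) :
    |∫ x, ∏ i ∈ Finset.range M, z ^ countOn d (cylinder ω n) (block m₀ b n i) x ∂P
      - Real.exp (-∑ i ∈ Finset.range M,
          ∫ x, (1 - z ^ countOn d (cylinder ω n) (block m₀ b n i) x) ∂P)|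
      ≤ M * ((κ ^ (4 * l) - 1) * (b * (κ * P.real (cylinder ω n)) ^ l)
        + (l * l * (2 * ∑ j, d j + 1) : ℕ) * ((b : ℝ) ^ 2 * (κ * P.real (cylinder ω n)) ^ (l + 1)
          + (b * (κ * P.real (cylinder ω n)) ^ l) ^ 2)
        + (b * (κ * P.real (cylinder ω n)) ^ l) ^ 2) := by
  have hp : 0 ≤ κ * P.real (cylinder ω n) := mul_nonneg (by linarith) measureReal_nonneg
  set W : ℕ → (ℕ → 𝒜) → ℕ := fun i => countOn d (cylinder ω n) (block m₀ b n i) with hW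
  have hWm : ∀ i, Measurable (W i) := fun i => measurable_countOn d ω n _
  have hfm : ∀ i, Measurable fun x => z ^ W i x := fun i =>
    (measurable_from_top (f := fun w : ℕ => z ^ w)).comp (hWm i)
  have hf0 : ∀ i x, 0 ≤ z ^ W i x := fun i x => pow_nonneg hz0 _
  have hf1 : ∀ i x, z ^ W i x ≤ 1 := fun i x => pow_le_one₀ hz0 hz1
  have hg0 : ∀ i x, 0 ≤ 1 - z ^ W i x := fun i x => sub_nonneg.2 (hf1 i x)
  have hgW : ∀ i x, 1 - z ^ W i x ≤ W i x := fun i x =>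
    (one_sub_pow_le hz0 _).trans (mul_le_of_le_one_right (Nat.cast_nonneg _) (by linarith))
  have hgm : ∀ i, Measurable fun x => 1 - z ^ W i x := fun i => measurable_const.sub (hfm i)
  have hm₁ : 1 ≤ m₀ := by omega
  have hη : ∀ m, ∫ x, (1 - z ^ W m x) ∂P ≤ b * (κ * P.real (cylinder ω n)) ^ l := fun m =>
    le_trans (integral_mono (integrable_of_mem_Icc (hgm m) (hg0 m)
      fun x => by linarith [hf0 m x]) (integrable_countOn d ω n _) (hgW m))
      (integral_countOn_block_le hinv hκ hd ω hn hU hb hm₁ m)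
  refine abs_integral_prod_sub_exp_le (near := nearBlocks d m₀) hfm hf0 hf1
    (fun m => Finset.filter_subset _ _) (by positivity) hη1 (by positivity)
    (fun m => by exact_mod_cast card_nearBlocks_le d hd1 m₀ m) (fun m => ?_) (fun m i him => ?_)
    hη M
  · have hk : 0 ≤ κ ^ (4 * l) - 1 := sub_nonneg.2 (one_le_pow₀ hκ)
    refine le_trans ?_ (mul_le_mul_of_nonneg_left (hη m) hk)
    -- Two cuts for each of the ℓ windows, and two factors κ for each cut.
    have h4 : 4 * l = 2 * (2 * l) := by ring
    rw [h4]
    refine (interlaced_blockCoords (m := m) hd hd1 hb hm₀).abs_integral_mul_sub_le hinv hκ hQ (hgm m)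
      (Finset.measurable_prod _ fun i _ => hfm i) ?_ ?_ (hg0 m) (fun x => by linarith [hf0 m x])
      (fun x => Finset.prod_nonneg fun i _ => hf0 i x)
      fun x => Finset.prod_le_one (fun i _ => hf0 i x) fun i _ => hf1 i x
    · intro x y hxy
      have : W m x = W m y := dependsOn_countOn_block hd1 ω hb hxy
      simp only [this]
    · intro x y hxy
      refine Finset.prod_congr rfl fun i hi => ?_
      have : W i x = W i y := dependsOn_countOn_block hd1 ω hb fun j hj =>
        hxy j (Set.mem_biUnion (Finset.mem_coe.2 hi) hj)
      rw [this]
  · refine le_trans (integral_mono ?_ (integrable_countOn_mul d ω n _ _) fun x =>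
      mul_le_mul (hgW i x) (hgW m x) (hg0 m x) (Nat.cast_nonneg _))
      (integral_countOn_block_mul_le hinv hκ hl hd hd1 ω hn hU hb hm₁ him)
    exact integrable_of_mem_Icc ((hgm i).mul (hgm m)) (fun x => mul_nonneg (hg0 i x) (hg0 m x))
      fun x => mul_le_one₀ (by linarith [hf0 i x]) (hg0 m x) (by linarith [hf0 m x])

theorem pairwiseDisjoint_block (m₀ b n : ℕ) (s : Set ℕ) : s.PairwiseDisjoint (block m₀ b n) := by
  intro i _ j _ hij
  refine Finset.disjoint_left.2 fun k hk hk' => hij ?_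
  rw [block, Finset.mem_Ico] at hk hk'
  rcases lt_trichotomy i j with h | h | h
  · have h1 : (m₀ + i + 1) * b ≤ (m₀ + j) * b := Nat.mul_le_mul_right _ (by omega)
    have h2 : (m₀ + i + 1) * b = (m₀ + i) * b + b := by ring
    omega
  · exact h
  · have h1 : (m₀ + j + 1) * b ≤ (m₀ + i) * b := Nat.mul_le_mul_right _ (by omega)
    have h2 : (m₀ + j + 1) * b = (m₀ + j) * b + b := by ring
    omega

theorem biUnion_block_subset {m₀ b n N : ℕ} (hb : 1 ≤ b) (hm₀ : 1 ≤ m₀) :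
    (Finset.range (N / b - m₀)).biUnion (block m₀ b n) ⊆ Finset.Icc 1 N := by
  intro k hk
  obtain ⟨i, hi, hk⟩ := Finset.mem_biUnion.1 hk
  rw [Finset.mem_range] at hi
  rw [block, Finset.mem_Ico] at hk
  have h1 : (m₀ + i + 1) * b ≤ N / b * b := Nat.mul_le_mul_right _ (by omega)
  have h2 : (m₀ + i + 1) * b = (m₀ + i) * b + b := by ring
  have h3 := Nat.div_mul_le_self N b
  have h4 : 1 * 1 ≤ (m₀ + i) * b := Nat.mul_le_mul (by omega) hb
  rw [Finset.mem_Icc]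
  omega

/-- The times up to `N` outside the blocks. -/
def remainder (m₀ b n N : ℕ) : Finset ℕ :=
  Finset.Icc 1 N \ (Finset.range (N / b - m₀)).biUnion (block m₀ b n)

theorem remainder_subset {m₀ b n N : ℕ} (hb : 1 ≤ b) :
    remainder m₀ b n N ⊆ (Finset.range (m₀ * b) ∪ Finset.Ico (N / b * b) (N / b * b + b)) ∪
      (Finset.range (N / b - m₀)).biUnion fun i =>
        Finset.Ico ((m₀ + i) * b + (b - 2 * n)) ((m₀ + i) * b + b) := by
  intro k hk
  rw [remainder, Finset.mem_sdiff, Finset.mem_Icc] at hk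
  obtain ⟨⟨_, hkN⟩, hk⟩ := hk
  have hmod : k / b * b + k % b = k := Nat.div_add_mod' k b
  have hlt := Nat.mod_lt k (show 0 < b by omega)
  have hdiv : k / b ≤ N / b := Nat.div_le_div_right hkN
  simp only [Finset.mem_union, Finset.mem_range, Finset.mem_Ico, Finset.mem_biUnion]
  -- The quotient k / b locates k: before the first block, in the final incomplete stretch, or at a
  -- block position, and then necessarily in its gap.
  rcases lt_or_ge (k / b) m₀ with h | h
  · left; left
    have h1 : (k / b + 1) * b ≤ m₀ * b := Nat.mul_le_mul_right _ h
    have h2 : (k / b + 1) * b = k / b * b + b := by ring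
    omega
  rcases eq_or_lt_of_le hdiv with h' | h'
  · left; right
    rw [← h']
    omega
  right
  refine ⟨k / b - m₀, by omega, ?_⟩
  have hnot : k ∉ block m₀ b n (k / b - m₀) := fun hmem =>
    hk (Finset.mem_biUnion.2 ⟨_, Finset.mem_range.2 (by omega), hmem⟩)
  rw [block, Finset.mem_Ico, Nat.add_sub_cancel' h] at hnot
  rw [Nat.add_sub_cancel' h]
  omega

theorem countOn_Icc_eq (A : Set (ℕ → 𝒜)) {m₀ b n N : ℕ} (hb : 1 ≤ b) (hm₀ : 1 ≤ m₀)
    (x : ℕ → 𝒜) :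
    countOn d A (Finset.Icc 1 N) x = countOn d A (remainder m₀ b n N) x
      + ∑ i ∈ Finset.range (N / b - m₀), countOn d A (block m₀ b n i) x := by
  unfold countOn remainder
  rw [← Finset.sum_biUnion (pairwiseDisjoint_block m₀ b n _),
    Finset.sum_sdiff (biUnion_block_subset hb hm₀)]

/-- Small times may have overlapping windows, and only the trivial bound p is used on the initial
and final stretches, which contain (m₀ + 1) b times in all. The gaps are numerous, but their times
exceed 2n, so the full power (κp)^ℓ is available. -/
theorem integral_countOn_remainder_le
    (hinv : MeasurePreserving (shift : (ℕ → 𝒜) → (ℕ → 𝒜)) P P)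
    {κ : ℝ} (hκ : 1 ≤ κ) (hl : 1 ≤ l) (hd : StrictMono d) (ω : ℕ → 𝒜)
    {m₀ b n : ℕ} (hn : 1 ≤ n) (hU : UpperMix P n κ) (hb : 2 * n ≤ b) (hm₀ : 1 ≤ m₀) (N : ℕ) :
    ∫ x, (countOn d (cylinder ω n) (remainder m₀ b n N) x : ℝ) ∂P
      ≤ (m₀ + 1) * (b * P.real (cylinder ω n))
        + ((N / b - m₀ : ℕ) : ℝ) * (2 * n * (κ * P.real (cylinder ω n)) ^ l) := by
  rw [integral_countOn]
  set r : ℕ → ℝ := fun k => P.real (returnEvent d (cylinder ω n) k) with hr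
  have hr0 : ∀ k, 0 ≤ r k := fun k => measureReal_nonneg
  have hrp : ∀ k, r k ≤ P.real (cylinder ω n) := fun k =>
    real_returnEvent_le_cylinder d hinv hl ω n k
  have hsum : ∀ s t : Finset ℕ, ∑ k ∈ s ∪ t, r k ≤ ∑ k ∈ s, r k + ∑ k ∈ t, r k := by
    intro s t
    rw [← Finset.sum_union_inter]
    exact le_add_of_nonneg_right (Finset.sum_nonneg fun k _ => hr0 k)
  have hbi : ∀ (s : Finset ℕ) (t : ℕ → Finset ℕ), ∑ k ∈ s.biUnion t, r k
      ≤ ∑ i ∈ s, ∑ k ∈ t i, r k := by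
    intro s t
    induction s using Finset.induction_on with
    | empty => simp
    | insert i s hi ih =>
      rw [Finset.biUnion_insert, Finset.sum_insert hi]
      exact (hsum _ _).trans (by linarith)
  have hcst : ∀ s : Finset ℕ, ∑ k ∈ s, r k ≤ s.card * P.real (cylinder ω n) := by
    intro s
    calc ∑ k ∈ s, r k ≤ ∑ _k ∈ s, P.real (cylinder ω n) := Finset.sum_le_sum fun k _ => hrp k
      _ = _ := by simp
  have h1 := hcst (Finset.range (m₀ * b))
  have h2 := hcst (Finset.Ico (N / b * b) (N / b * b + b))
  rw [Finset.card_range] at h1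
  rw [Nat.card_Ico, Nat.add_sub_cancel_left] at h2
  have h3 : ∑ i ∈ Finset.range (N / b - m₀),
      ∑ k ∈ Finset.Ico ((m₀ + i) * b + (b - 2 * n)) ((m₀ + i) * b + b), r k
      ≤ ((N / b - m₀ : ℕ) : ℝ) * (2 * n * (κ * P.real (cylinder ω n)) ^ l) := by
    calc _ ≤ ∑ _i ∈ Finset.range (N / b - m₀), 2 * n * (κ * P.real (cylinder ω n)) ^ l := by
          refine Finset.sum_le_sum fun i _ => ?_
          calc _ ≤ ∑ _k ∈ Finset.Ico ((m₀ + i) * b + (b - 2 * n)) ((m₀ + i) * b + b),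
                (κ * P.real (cylinder ω n)) ^ l := by
                refine Finset.sum_le_sum fun k hk => ?_
                rw [Finset.mem_Ico] at hk
                have h1 : 1 * b ≤ (m₀ + i) * b := Nat.mul_le_mul_right _ (by omega)
                exact real_returnEvent_le hinv hκ hU hd ω hn (by omega)
            _ = _ := by
                rw [Finset.sum_const, Nat.card_Ico, nsmul_eq_mul]
                congr 1
                have : (m₀ + i) * b + b - ((m₀ + i) * b + (b - 2 * n)) = 2 * n := by omega
                rw [this]
                push_cast
                ring
      _ = _ := by simp
  have h4 := Finset.sum_le_sum_of_subset_of_nonneg (remainder_subset (m₀ := m₀) (n := n) (N := N)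
    (show 1 ≤ b by omega)) fun k _ _ => hr0 k
  have h5 := hsum (Finset.range (m₀ * b) ∪ Finset.Ico (N / b * b) (N / b * b + b))
    ((Finset.range (N / b - m₀)).biUnion fun i =>
        Finset.Ico ((m₀ + i) * b + (b - 2 * n)) ((m₀ + i) * b + b))
  have h6 := hsum (Finset.range (m₀ * b)) (Finset.Ico (N / b * b) (N / b * b + b))
  have h7 := hbi (Finset.range (N / b - m₀)) fun i =>
        Finset.Ico ((m₀ + i) * b + (b - 2 * n)) ((m₀ + i) * b + b)
  push_cast at h1
  have h8 : (m₀ + 1) * (b * P.real (cylinder ω n))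
    = m₀ * b * P.real (cylinder ω n) + b * P.real (cylinder ω n) := by ring
  linarith

theorem abs_integral_pow_count_sub_prod_le (ω : ℕ → 𝒜) {m₀ b n : ℕ} (hb : 1 ≤ b) (hm₀ : 1 ≤ m₀)
    (N : ℕ) {z : ℝ} (hz0 : 0 ≤ z) (hz1 : z ≤ 1) :
    |∫ x, z ^ returnCount d (cylinder ω n) N x ∂P
      - ∫ x, ∏ i ∈ Finset.range (N / b - m₀),
          z ^ countOn d (cylinder ω n) (block m₀ b n i) x ∂P|
      ≤ ∫ x, (countOn d (cylinder ω n) (remainder m₀ b n N) x : ℝ) ∂P := by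
  have hpm : ∀ s, Measurable fun x => z ^ countOn d (cylinder ω n) s x := fun s =>
    (measurable_from_top (f := fun w : ℕ => z ^ w)).comp (measurable_countOn d ω n s)
  have h0 : ∀ w : ℕ, 0 ≤ z ^ w := fun w => pow_nonneg hz0 _
  have h1 : ∀ w : ℕ, z ^ w ≤ 1 := fun w => pow_le_one₀ hz0 hz1
  have hprodm : Measurable fun x => ∏ i ∈ Finset.range (N / b - m₀),
      z ^ countOn d (cylinder ω n) (block m₀ b n i) x :=
    Finset.measurable_prod _ fun i _ => hpm _
  have i1 : Integrable (fun x => z ^ countOn d (cylinder ω n) (Finset.Icc 1 N) x) P :=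
    integrable_of_mem_Icc (hpm _) (fun x => h0 _) fun x => h1 _
  have i2 : Integrable (fun x => ∏ i ∈ Finset.range (N / b - m₀),
      z ^ countOn d (cylinder ω n) (block m₀ b n i) x) P :=
    integrable_of_mem_Icc hprodm (fun x => Finset.prod_nonneg fun i _ => h0 _)
      fun x => Finset.prod_le_one (fun i _ => h0 _) fun i _ => h1 _
  rw [returnCount_eq_countOn, ← integral_sub i1 i2]
  refine (abs_integral_le_integral_abs).trans (integral_mono (i1.sub i2).abs
    (integrable_countOn d ω n _) fun x => ?_)
  simp only
  rw [Finset.prod_pow_eq_pow_sum, countOn_Icc_eq _ hb hm₀ x, pow_add, abs_sub_comm]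
  set w := countOn d (cylinder ω n) (remainder m₀ b n N) x
  set v := ∑ i ∈ Finset.range (N / b - m₀), countOn d (cylinder ω n) (block m₀ b n i) x
  have h2 : z ^ v - z ^ w * z ^ v = z ^ v * (1 - z ^ w) := by ring
  have h3 : 0 ≤ 1 - z ^ w := sub_nonneg.2 (h1 w)
  rw [h2, abs_of_nonneg (mul_nonneg (h0 v) h3)]
  refine (mul_le_of_le_one_left h3 (h1 v)).trans ((one_sub_pow_le hz0 w).trans ?_)
  exact mul_le_of_le_one_right (Nat.cast_nonneg _) (by linarith)

/-- The expected number of blocks among the first `M` with more than `j` returns. -/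
noncomputable def blockTail (P : Measure (ℕ → 𝒜)) (d : Fin l → ℕ) (ω : ℕ → 𝒜)
    (m₀ b n M j : ℕ) : ℝ :=
  ∑ i ∈ Finset.range M, P.real {x | j < countOn d (cylinder ω n) (block m₀ b n i) x}

theorem blockTail_nonneg (ω : ℕ → 𝒜) (m₀ b n M j : ℕ) : 0 ≤ blockTail P d ω m₀ b n M j :=
  Finset.sum_nonneg fun _ _ => measureReal_nonneg

theorem blockTail_anti (ω : ℕ → 𝒜) (m₀ b n M : ℕ) : Antitone (blockTail P d ω m₀ b n M) :=
  fun _ _ hij => Finset.sum_le_sum fun _ _ => measureReal_mono fun _ hx => lt_of_le_of_lt hij hx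

theorem multiReturn_le_one (A : Set (ℕ → 𝒜)) (k : ℕ) (x : ℕ → 𝒜) : multiReturn d A k x ≤ 1 := by
  have h : (multiReturn d A k x : ℝ) ≤ 1 := by
    rw [multiReturn_eq_indicator]
    exact Set.indicator_le_self' (fun _ _ => zero_le_one) x
  exact_mod_cast h

theorem countOn_le_card (A : Set (ℕ → 𝒜)) (s : Finset ℕ) (x : ℕ → 𝒜) :
    countOn d A s x ≤ s.card := by
  calc countOn d A s x ≤ ∑ _k ∈ s, 1 := Finset.sum_le_sum fun k _ => multiReturn_le_one A k x
    _ = s.card := by simp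

/-- Markov's inequality for each block count at level j + 1. The decay in j is what later keeps mass
from escaping to infinity. -/
theorem mul_blockTail_le (hinv : MeasurePreserving (shift : (ℕ → 𝒜) → (ℕ → 𝒜)) P P)
    {κ : ℝ} (hκ : 1 ≤ κ) (hd : StrictMono d) (ω : ℕ → 𝒜) {m₀ b n : ℕ} (hn : 1 ≤ n)
    (hU : UpperMix P n κ) (hb : 2 * n ≤ b) (hm₀ : 1 ≤ m₀) (M j : ℕ) :
    (j + 1) * blockTail P d ω m₀ b n M j ≤ M * (b * (κ * P.real (cylinder ω n)) ^ l) := by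
  rw [blockTail, Finset.mul_sum]
  calc _ ≤ ∑ _i ∈ Finset.range M, b * (κ * P.real (cylinder ω n)) ^ l := by
        refine Finset.sum_le_sum fun i _ => ?_
        refine le_trans ?_ (integral_countOn_block_le hinv hκ hd ω hn hU hb hm₀ i)
        have := mul_meas_ge_le_integral_of_nonneg (μ := P)
          (f := fun x => (countOn d (cylinder ω n) (block m₀ b n i) x : ℝ))
          (ae_of_all _ fun x => Nat.cast_nonneg _) (integrable_countOn d ω n _) (j + 1)
        refine le_trans (le_of_eq ?_) this
        congr 2
        ext x
        simp only [Set.mem_ofPred_eq]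
        exact_mod_cast Nat.lt_iff_add_one_le
    _ = _ := by simp

/-- Integrate 1 - z^w = (1 - z) ∑_{j < w} z^j. The series is a finite sum, because a block holds at
most b returns. -/
theorem sum_integral_one_sub_pow (ω : ℕ → 𝒜) (m₀ b n M : ℕ) (z : ℝ) :
    ∑ i ∈ Finset.range M, ∫ x, (1 - z ^ countOn d (cylinder ω n) (block m₀ b n i) x) ∂P
      = (1 - z) * ∑' j, z ^ j * blockTail P d ω m₀ b n M j := by
  have hzero : ∀ j, j ∉ Finset.range b → z ^ j * blockTail P d ω m₀ b n M j = 0 := by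
    intro j hj
    rw [Finset.mem_range, not_lt] at hj
    rw [blockTail, Finset.sum_eq_zero, mul_zero]
    intro i _
    have : {x | j < countOn d (cylinder ω n) (block m₀ b n i) x} = ∅ := by
      refine Set.eq_empty_of_forall_notMem fun x hx => ?_
      have h1 : j < countOn d (cylinder ω n) (block m₀ b n i) x := hx
      have := (countOn_le_card (d := d) (cylinder ω n) (block m₀ b n i) x).trans
        (card_block_le m₀ b n i)
      omega
    rw [this, measureReal_empty]
  rw [tsum_eq_sum hzero, Finset.mul_sum]
  simp only [blockTail, Finset.mul_sum]
  rw [Finset.sum_comm]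
  refine Finset.sum_congr rfl fun i _ => ?_
  have hm : ∀ j, MeasurableSet {x | j < countOn d (cylinder ω n) (block m₀ b n i) x} := fun j =>
    measurable_countOn d ω n _ measurableSet_Ioi
  have hpt : ∀ x, 1 - z ^ countOn d (cylinder ω n) (block m₀ b n i) x
      = ∑ j ∈ Finset.range b, (1 - z) * (z ^ j *
        {x | j < countOn d (cylinder ω n) (block m₀ b n i) x}.indicator 1 x) := by
    intro x
    have hle := (countOn_le_card (d := d) (cylinder ω n) (block m₀ b n i) x).trans
      (card_block_le m₀ b n i)
    set w := countOn d (cylinder ω n) (block m₀ b n i) x with hw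
    rw [← mul_neg_geom_sum, ← Finset.mul_sum]
    congr 1
    rw [← Finset.sum_subset (Finset.range_mono hle)]
    · refine Finset.sum_congr rfl fun j hj => ?_
      have hx : x ∈ {x | j < countOn d (cylinder ω n) (block m₀ b n i) x} := Finset.mem_range.1 hj
      rw [Set.indicator_of_mem hx, Pi.one_apply, mul_one]
    · intro j _ hj
      have hx : x ∉ {x | j < countOn d (cylinder ω n) (block m₀ b n i) x} := fun h =>
        hj (Finset.mem_range.2 h)
      rw [Set.indicator_of_notMem hx, mul_zero]
  simp only [hpt]
  rw [integral_finsetSum _ fun j _ => ((integrable_indicator_one (hm j)).const_mul _).const_mul _]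
  refine Finset.sum_congr rfl fun j _ => ?_
  rw [integral_const_mul, integral_const_mul, integral_indicator_one (hm j)]

end Approximation

/-! ### Generating functions, compound Poisson laws and compactness -/

theorem summable_pow_mul_of_le {z C : ℝ} (hz0 : 0 ≤ z) (hz1 : z < 1) {a : ℕ → ℝ}
    (ha : ∀ j, |a j| ≤ C) : Summable fun j => z ^ j * a j :=
  Summable.of_norm_bounded ((summable_geometric_of_lt_one hz0 hz1).mul_right C) fun j => by
    rw [Real.norm_eq_abs, abs_mul, abs_of_nonneg (pow_nonneg hz0 j)]
    exact mul_le_mul_of_nonneg_left (ha j) (pow_nonneg hz0 j)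

theorem lintegral_pow_convPow (θ : Measure ℕ) [IsProbabilityMeasure θ] {z G : ℝ} (hz0 : 0 ≤ z)
    (hG0 : 0 ≤ G) (hθ : ∫⁻ k, ENNReal.ofReal (z ^ k) ∂θ = ENNReal.ofReal G) (j : ℕ) :
    ∫⁻ k, ENNReal.ofReal (z ^ k) ∂convPow θ j = ENNReal.ofReal (G ^ j) := by
  induction j with
  | zero => simp [convPow]
  | succ j ih =>
    rw [convPow, Measure.lintegral_conv (measurable_from_top)]
    simp only [pow_add, ENNReal.ofReal_mul (pow_nonneg hz0 _)]
    simp only [lintegral_const_mul _ (measurable_from_top : Measurable fun k : ℕ =>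
      ENNReal.ofReal (z ^ k)), hθ]
    rw [lintegral_mul_const _ measurable_from_top, ih, pow_one,
      ENNReal.ofReal_mul (pow_nonneg hG0 _)]

theorem lintegral_pow_compoundPoisson (τ : ℝ≥0) (θ : Measure ℕ) [IsProbabilityMeasure θ]
    {z G : ℝ} (hz0 : 0 ≤ z) (hG0 : 0 ≤ G)
    (hθ : ∫⁻ k, ENNReal.ofReal (z ^ k) ∂θ = ENNReal.ofReal G) :
    ∫⁻ k, ENNReal.ofReal (z ^ k) ∂compoundPoisson τ θ
      = ENNReal.ofReal (Real.exp (τ * (G - 1))) := by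
  rw [compoundPoisson, lintegral_sum_measure]
  simp only [lintegral_smul_measure, lintegral_pow_convPow θ hz0 hG0 hθ, poissonMeasure_singleton,
    smul_eq_mul]
  have hnn : ∀ j : ℕ, 0 ≤ Real.exp (-τ) * (τ : ℝ) ^ j / (j.factorial : ℝ) := fun j => by positivity
  have hs : HasSum (fun j : ℕ => Real.exp (-τ) * (τ : ℝ) ^ j / (j.factorial : ℝ) * G ^ j)
      (Real.exp (τ * (G - 1))) := by
    have h := (NormedSpace.expSeries_div_hasSum_exp ((τ : ℝ) * G)).mul_left (Real.exp (-τ))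
    rw [← Real.exp_eq_exp_ℝ, ← Real.exp_add] at h
    convert! h using 1
    · funext j
      rw [mul_pow]
      ring
    · congr 1
      ring
  simp only [← ENNReal.ofReal_mul (hnn _)]
  rw [← ENNReal.ofReal_tsum_of_nonneg (fun j => mul_nonneg (hnn j) (pow_nonneg hG0 j)) hs.summable,
    hs.tsum_eq]

instance isProbabilityMeasure_compoundPoisson (τ : ℝ≥0) (θ : Measure ℕ) [IsProbabilityMeasure θ] :
    IsProbabilityMeasure (compoundPoisson τ θ) := by
  have := lintegral_pow_compoundPoisson τ θ (z := 1) (G := 1) zero_le_one zero_le_one (by simp)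
  exact ⟨by simpa using this⟩

/-- A nonincreasing sequence `L` with `(j + 1) L j ≤ t` is, up to the factor `t`, the sequence
of tails of a probability measure on `ℕ`. -/
theorem exists_isProbabilityMeasure_of_tail {t : ℝ} (ht : 0 < t) {L : ℕ → ℝ} (hL : Antitone L)
    (hL0 : ∀ j, 0 ≤ L j) (hLt : ∀ j, (j + 1) * L j ≤ t) :
    ∃ θ : Measure ℕ, IsProbabilityMeasure θ ∧ ∀ z : ℝ, 0 ≤ z → z < 1 →
      0 ≤ 1 - (1 - z) * (∑' j, z ^ j * L j) / t ∧
      ∫⁻ k, ENNReal.ofReal (z ^ k) ∂θ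
        = ENNReal.ofReal (1 - (1 - z) * (∑' j, z ^ j * L j) / t) := by
  -- Putting t in front of L turns the defect t - L 0 into an atom of θ at 0, so the Poisson
  -- parameter can be t itself.
  set a : ℕ → ℝ := fun j => Nat.casesOn j t L with ha
  have hLt' : ∀ j, L j ≤ t := fun j => by
    have h1 := hLt j
    have h2 : 0 ≤ (j : ℝ) * L j := mul_nonneg (Nat.cast_nonneg j) (hL0 j)
    linarith
  have hanti : ∀ j, a (j + 1) ≤ a j := by
    rintro (_ | j)
    · exact hLt' 0
    · exact hL (Nat.le_succ j)
  set w : ℕ → ℝ := fun j => (a j - a (j + 1)) / t with hw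
  have hw0 : ∀ j, 0 ≤ w j := fun j => div_nonneg (sub_nonneg.2 (hanti j)) ht.le
  -- No mass is lost at infinity, so the increments of a / t have total mass one.
  have hLlim : Tendsto L atTop (𝓝 0) := by
    refine squeeze_zero hL0 (fun j => ?_)
      ((tendsto_one_div_add_atTop_nhds_zero_nat (𝕜 := ℝ)).const_mul t |>.trans
        (by rw [mul_zero]))
    rw [mul_one_div, le_div_iff₀ (by positivity), mul_comm]
    exact hLt j
  have hw1 : HasSum w 1 := by
    rw [hasSum_iff_tendsto_nat_of_nonneg hw0]
    have halim : Tendsto a atTop (𝓝 0) := (tendsto_add_atTop_iff_nat 1).1 hLlim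
    have hsum : ∀ n, ∑ i ∈ Finset.range n, w i = (t - a n) / t := by
      intro n
      rw [← Finset.sum_div, Finset.sum_range_sub' a n]
      rfl
    simp only [hsum]
    have := (halim.const_sub t).div_const t
    rwa [sub_zero, div_self ht.ne'] at this
  refine ⟨Measure.sum fun j => ENNReal.ofReal (w j) • Measure.dirac j,
    hw1.isProbabilityMeasure_sum_dirac hw0, fun z hz0 hz1 => ?_⟩
  set S := ∑' j, z ^ j * L j with hS
  have hsL : HasSum (fun j => z ^ j * L j) S :=
    (summable_pow_mul_of_le hz0 hz1 (C := t) fun j => by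
      rw [abs_of_nonneg (hL0 j)]; exact hLt' j).hasSum
  have hsa : HasSum (fun j => z ^ j * a j) (z * S + t) := by
    have h := hsL.mul_left z
    have h1 : HasSum (fun j => z ^ (j + 1) * a (j + 1)) (z * S) := by
      convert! h using 1
      funext j
      simp only [ha]
      ring
    have h2 := (hasSum_nat_add_iff (f := fun j => z ^ j * a j) 1).1 h1
    simpa [ha] using h2
  have hsw : HasSum (fun j => w j * z ^ j) (1 - (1 - z) * S / t) := by
    have h := (hsa.sub hsL).div_const t
    convert! h using 1
    · funext j
      simp only [hw, ha]
      ring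
    · field_simp
      ring
  refine ⟨hsw.nonneg fun j => mul_nonneg (hw0 j) (pow_nonneg hz0 j), ?_⟩
  rw [lintegral_sum_measure]
  simp only [lintegral_smul_measure, lintegral_dirac, smul_eq_mul, ← ENNReal.ofReal_mul (hw0 _)]
  rw [← ENNReal.ofReal_tsum_of_nonneg (fun j => mul_nonneg (hw0 j) (pow_nonneg hz0 j))
    hsw.summable, hsw.tsum_eq]

theorem lintegral_pow_eq_tsum (μ : Measure ℕ) [IsProbabilityMeasure μ] {z : ℝ} (hz0 : 0 ≤ z)
    (hz1 : z < 1) :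
    ∫⁻ k, ENNReal.ofReal (z ^ k) ∂μ = ENNReal.ofReal (∑' k, z ^ k * μ.real {k}) := by
  rw [lintegral_countable', ENNReal.ofReal_tsum_of_nonneg
    (fun k => mul_nonneg (pow_nonneg hz0 k) measureReal_nonneg)
    (summable_pow_mul_of_le hz0 hz1 (C := 1) fun j => by
      rw [abs_of_nonneg measureReal_nonneg]; exact measureReal_le_one)]
  refine tsum_congr fun k => ?_
  rw [ENNReal.ofReal_mul (pow_nonneg hz0 k), ofReal_measureReal]

/-- Once the lower coefficients vanish, divide by z^k and let z decrease to 0. -/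
theorem eq_zero_of_tsum_pow_mul_eq_zero {a : ℕ → ℝ} {C : ℝ} (ha : ∀ j, |a j| ≤ C)
    (h : ∀ z : ℝ, 0 < z → z < 1 → ∑' k, z ^ k * a k = 0) (k : ℕ) : a k = 0 := by
  induction k using Nat.strong_induction_on with
  | _ k ih =>
    have hz : ∀ z : ℝ, 0 < z → z < 1 → ∑' i, z ^ i * a (i + k) = 0 := by
      intro z hz0 hz1
      have h1 := (summable_pow_mul_of_le hz0.le hz1 ha).sum_add_tsum_nat_add k
      rw [h z hz0 hz1, Finset.sum_eq_zero (fun i hi => by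
        rw [ih i (Finset.mem_range.1 hi), mul_zero]), zero_add] at h1
      have h2 : ∀ i, z ^ (i + k) * a (i + k) = z ^ k * (z ^ i * a (i + k)) := fun i => by ring
      simp only [h2, tsum_mul_left] at h1
      exact (mul_eq_zero.1 h1).resolve_left (pow_pos hz0 k).ne'
    have hlim : Tendsto (fun z : ℝ => ∑' i, z ^ i * a (i + k)) (𝓝[>] 0)
        (𝓝 (∑' i, (0 : ℝ) ^ i * a (i + k))) := by
      refine tendsto_tsum_of_dominated_convergence (bound := fun i => (1 / 2 : ℝ) ^ i * C)
        ((summable_geometric_of_lt_one (by norm_num) (by norm_num)).mul_right C) (fun i => ?_) ?_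
      · exact (((continuous_pow i).tendsto (0 : ℝ)).mono_left nhdsWithin_le_nhds).mul_const _
      · filter_upwards [Ioo_mem_nhdsGT (show (0 : ℝ) < 1 / 2 by norm_num)] with z hz i
        rw [Real.norm_eq_abs, abs_mul, abs_of_nonneg (pow_nonneg hz.1.le i)]
        exact mul_le_mul (pow_le_pow_left₀ hz.1.le hz.2.le i) (ha _) (abs_nonneg _) (by positivity)
    have h0 : ∑' i, (0 : ℝ) ^ i * a (i + k) = a k := by
      rw [tsum_eq_single 0 fun i hi => by rw [zero_pow hi, zero_mul]]
      simp
    rw [h0] at hlim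
    refine tendsto_nhds_unique hlim (tendsto_const_nhds.congr' ?_)
    filter_upwards [Ioo_mem_nhdsGT (show (0 : ℝ) < 1 by norm_num)] with z hz'
    exact (hz z hz'.1 hz'.2).symm

theorem ext_of_lintegral_pow {μ ν : Measure ℕ} [IsProbabilityMeasure μ] [IsProbabilityMeasure ν]
    (h : ∀ z : ℝ, 0 < z → z < 1 →
      ∫⁻ k, ENNReal.ofReal (z ^ k) ∂μ = ∫⁻ k, ENNReal.ofReal (z ^ k) ∂ν) : μ = ν := by
  have hb : ∀ (ρ : Measure ℕ) [IsProbabilityMeasure ρ] (j : ℕ), |ρ.real {j}| ≤ 1 := fun ρ _ j => by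
    rw [abs_of_nonneg measureReal_nonneg]; exact measureReal_le_one
  refine Measure.ext_of_singleton fun k => ?_
  have := eq_zero_of_tsum_pow_mul_eq_zero (a := fun j => μ.real {j} - ν.real {j}) (C := 2)
    (fun j => (abs_sub _ _).trans (by linarith [hb μ j, hb ν j])) (fun z hz0 hz1 => ?_) k
  · rw [← ofReal_measureReal, ← ofReal_measureReal, sub_eq_zero.1 this]
  · have e := h z hz0 hz1
    have hnn : ∀ (ρ : Measure ℕ), 0 ≤ ∑' k, z ^ k * ρ.real {k} := fun ρ =>
      tsum_nonneg fun k => mul_nonneg (pow_nonneg hz0.le k) measureReal_nonneg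
    rw [lintegral_pow_eq_tsum μ hz0.le hz1, lintegral_pow_eq_tsum ν hz0.le hz1,
      ENNReal.ofReal_eq_ofReal_iff (hnn μ) (hnn ν)] at e
    simp only [mul_sub]
    rw [(summable_pow_mul_of_le hz0.le hz1 (hb μ)).tsum_sub
      (summable_pow_mul_of_le hz0.le hz1 (hb ν)), e, sub_self]

/-- Helly selection for uniformly decaying tail sequences, with convergence of the generating
functions. -/
theorem exists_subseq_tendsto_tail {Λ : ℕ → ℕ → ℝ} {Y : ℕ → ℝ} {t : ℝ}
    (hY : Tendsto Y atTop (𝓝 t)) (h0 : ∀ n j, 0 ≤ Λ n j) (hanti : ∀ n, Antitone (Λ n))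
    (hΛ : ∀ᶠ n in atTop, ∀ j : ℕ, (j + 1) * Λ n j ≤ Y n) :
    ∃ (φ : ℕ → ℕ) (L : ℕ → ℝ), StrictMono φ ∧ Antitone L ∧ (∀ j, 0 ≤ L j) ∧
      (∀ j : ℕ, (j + 1) * L j ≤ t) ∧ ∀ z : ℝ, 0 ≤ z → z < 1 →
        Tendsto (fun n => ∑' j, z ^ j * Λ (φ n) j) atTop (𝓝 (∑' j, z ^ j * L j)) := by
  have hbd : ∀ᶠ n in atTop, ∀ j, Λ n j ≤ t + 1 := by
    filter_upwards [hΛ, hY.eventually (gt_mem_nhds (show t < t + 1 by linarith))] with n hn hn' j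
    have h1 := hn j
    have h2 : 0 ≤ (j : ℝ) * Λ n j := mul_nonneg (Nat.cast_nonneg j) (h0 n j)
    linarith
  have hcomp : IsCompact (Set.univ.pi fun _ : ℕ => Set.Icc (0 : ℝ) (t + 1)) :=
    isCompact_univ_pi fun _ => isCompact_Icc
  -- Compactness of a countable product of intervals replaces a diagonal argument; the sequence need
  -- only lie in it frequently.
  obtain ⟨L, -, φ, hφ, hlim⟩ := hcomp.tendsto_subseq' (x := Λ)
    (hbd.mono fun n hn j _ => ⟨h0 n j, hn j⟩).frequently
  have hlimj : ∀ j, Tendsto (fun n => Λ (φ n) j) atTop (𝓝 (L j)) := fun j =>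
    (tendsto_pi_nhds.1 hlim) j
  refine ⟨φ, L, hφ, fun i j hij => le_of_tendsto_of_tendsto' (hlimj j) (hlimj i) fun n =>
    hanti _ hij, fun j => ge_of_tendsto' (hlimj j) fun n => h0 _ j, fun j => ?_,
    fun z hz0 hz1 => ?_⟩
  · exact le_of_tendsto_of_tendsto ((hlimj j).const_mul _) (hY.comp hφ.tendsto_atTop)
      ((hφ.tendsto_atTop.eventually hΛ).mono fun n hn => hn j)
  · refine tendsto_tsum_of_dominated_convergence (bound := fun j => z ^ j * (t + 1))
      ((summable_geometric_of_lt_one hz0 hz1).mul_right _) (fun j => (hlimj j).const_mul _) ?_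
    filter_upwards [hφ.tendsto_atTop.eventually hbd] with n hn j
    rw [Real.norm_eq_abs, abs_mul, abs_of_nonneg (pow_nonneg hz0 j), abs_of_nonneg (h0 _ j)]
    exact mul_le_mul_of_nonneg_left (hn j) (pow_nonneg hz0 j)

/-- Weak limits of laws on `ℕ` are carried by `ℕ`, and their generating functions are the limits
of the generating functions. -/
theorem exists_measure_nat_of_tendsto_onReal {ν : ℕ → ProbabilityMeasure ℕ}
    {μ : ProbabilityMeasure ℝ} (h : Tendsto (fun k => onReal (ν k)) atTop (𝓝 μ)) :
    ∃ ρ : Measure ℕ, IsProbabilityMeasure ρ ∧ (μ : Measure ℝ) = ρ.map (fun k : ℕ => (k : ℝ)) ∧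
      ∀ z : ℝ, 0 < z → z < 1 →
        Tendsto (fun k => ∫ i, z ^ i ∂(ν k : Measure ℕ)) atTop (𝓝 (∫ i, z ^ i ∂ρ)) := by
  have hemb : MeasurableEmbedding (fun k : ℕ => (k : ℝ)) :=
    Nat.isClosedEmbedding_coe_real.measurableEmbedding
  have hclosed : IsClosed (Set.range fun k : ℕ => (k : ℝ)) :=
    Nat.isClosedEmbedding_coe_real.isClosed_range
  have honReal : ∀ k, (onReal (ν k) : Measure ℝ) = (ν k : Measure ℕ).map fun k : ℕ => (k : ℝ) :=
    fun k => rfl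
  have hone : ∀ k, (onReal (ν k) : Measure ℝ) (Set.range fun k : ℕ => (k : ℝ)) = 1 := by
    intro k
    rw [honReal, hemb.map_apply, Set.preimage_range, measure_univ]
  -- Portmanteau for the closed set ℕ ⊂ ℝ.
  have hrange : (μ : Measure ℝ) (Set.range fun k : ℕ => (k : ℝ)) = 1 := by
    refine le_antisymm prob_le_one ?_
    have := ProbabilityMeasure.limsup_measure_closed_le_of_tendsto h hclosed
    simpa only [hone, limsup_const] using this
  have hmap : ((μ : Measure ℝ).comap fun k : ℕ => (k : ℝ)).map (fun k : ℕ => (k : ℝ)) = μ := by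
    rw [hemb.map_comap, Measure.restrict_eq_self_of_ae_mem]
    exact (mem_ae_iff_prob_eq_one hclosed.measurableSet).2 hrange
  refine ⟨(μ : Measure ℝ).comap fun k : ℕ => (k : ℝ), ⟨?_⟩, hmap.symm, fun z hz0 hz1 => ?_⟩
  · rw [hemb.comap_apply, Set.image_univ, hrange]
  · have hcont : Continuous fun x : ℝ => z ^ |x| :=
      Continuous.rpow continuous_const continuous_abs fun x => Or.inl hz0.ne'
    let g : BoundedContinuousFunction ℝ ℝ := BoundedContinuousFunction.ofNormedAddCommGroup
      (fun x : ℝ => z ^ |x|) hcont 1 fun x => by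
        rw [Real.norm_eq_abs, abs_of_nonneg (Real.rpow_nonneg hz0.le _)]
        exact Real.rpow_le_one hz0.le hz1.le (abs_nonneg x)
    have hg : ∀ i : ℕ, g (i : ℝ) = z ^ i := by
      intro i
      change z ^ |(i : ℝ)| = z ^ i
      rw [abs_of_nonneg (Nat.cast_nonneg i), Real.rpow_natCast]
    have hlim := ProbabilityMeasure.tendsto_iff_forall_integral_tendsto.1 h g
    rw [← hmap, hemb.integral_map] at hlim
    simp only [honReal, hemb.integral_map, hg] at hlim
    exact hlim

/-! ### Asymptotics along the cylinders -/

section Limit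

variable {𝒜 : Type*} [Countable 𝒜] [MeasurableSpace 𝒜] [DiscreteMeasurableSpace 𝒜]
  {P : Measure (ℕ → 𝒜)} [IsProbabilityMeasure P] {l : ℕ} {d : Fin l → ℕ}

theorem returnTime_mul_le {t : ℝ} (ht : 0 ≤ t) (ω : ℕ → 𝒜) (n : ℕ) :
    (returnTime P l t ω n : ℝ) * P.real (cylinder ω n) ^ l ≤ t := by
  have hp : 0 ≤ P.real (cylinder ω n) ^ l := pow_nonneg measureReal_nonneg _
  calc _ ≤ t * (P.real (cylinder ω n) ^ l)⁻¹ * P.real (cylinder ω n) ^ l :=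
        mul_le_mul_of_nonneg_right (Nat.floor_le (by positivity)) hp
    _ ≤ t := by
      rw [mul_assoc]
      exact mul_le_of_le_one_right ht inv_mul_le_one

theorem numBlocks_mul_le {t κ : ℝ} (ht : 0 ≤ t) (hκ : 0 ≤ κ) (ω : ℕ → 𝒜) (n b m₀ : ℕ) :
    ((returnTime P l t ω n / b - m₀ : ℕ) : ℝ) * (b * (κ * P.real (cylinder ω n)) ^ l)
      ≤ κ ^ l * t := by
  have hp : 0 ≤ P.real (cylinder ω n) ^ l := pow_nonneg measureReal_nonneg _
  have h1 : ((returnTime P l t ω n / b - m₀ : ℕ) : ℝ) * b ≤ returnTime P l t ω n := by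
    have : (returnTime P l t ω n / b - m₀) * b ≤ returnTime P l t ω n :=
      (Nat.mul_le_mul_right b (Nat.sub_le _ _)).trans (Nat.div_mul_le_self _ _)
    exact_mod_cast this
  calc _ = κ ^ l * (((returnTime P l t ω n / b - m₀ : ℕ) : ℝ) * b * P.real (cylinder ω n) ^ l) := by
        rw [mul_pow]; ring
    _ ≤ κ ^ l * (returnTime P l t ω n * P.real (cylinder ω n) ^ l) := by gcongr
    _ ≤ κ ^ l * t := by gcongr; exact returnTime_mul_le ht ω n

/-- The choice b = n² balances two needs: b p → 0 makes each block rarely hit, and n / b → 0 makes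
the gaps negligible. With X = b (κp)^ℓ bounding the mean of a block, M X stays bounded by κ^ℓ t, and
every error is either M X times a null sequence or one of the two remainder terms. -/
theorem tendsto_integral_pow_sub_exp (hinv : MeasurePreserving (shift : (ℕ → 𝒜) → (ℕ → 𝒜)) P P)
    {κ : ℕ → ℝ} (hκ1 : ∀ g, 1 ≤ κ g) (hκ : Tendsto κ atTop (𝓝 1))
    (hU : ∀ g, UpperMix P g (κ g))
    (hQ : ∀ᶠ g in atTop, QuasiIndep P g (ENNReal.ofReal (κ g)))
    (hl : 1 ≤ l) (hd : StrictMono d) (hd1 : ∀ j, 1 ≤ d j) {t : ℝ} (ht : 0 < t) (ω : ℕ → 𝒜)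
    (hdecay : Tendsto (fun n : ℕ => (n : ℝ) ^ 2 * P.real (cylinder ω n)) atTop (𝓝 0))
    {m₀ : ℕ} (hm₀ : ∑ j, d j + 2 ≤ m₀) {z : ℝ} (hz0 : 0 ≤ z) (hz1 : z ≤ 1) :
    Tendsto (fun n => ∫ x, z ^ returnCount d (cylinder ω n) (returnTime P l t ω n) x ∂P
      - Real.exp (-((1 - z) * ∑' j, z ^ j *
          blockTail P d ω m₀ (n ^ 2) n (returnTime P l t ω n / n ^ 2 - m₀) j))) atTop (𝓝 0) := by
  set c : ℝ := ((l * l * (2 * ∑ j, d j + 1) : ℕ) : ℝ) with hc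
  set β : ℕ → ℝ := fun n => (n : ℝ) ^ 2 * P.real (cylinder ω n) with hβ
  set Y : ℕ → ℝ := fun n => κ n ^ l * t with hY
  have hκβ : Tendsto (fun n => κ n * β n) atTop (𝓝 0) := by
    simpa using hκ.mul hdecay
  have hYlim : Tendsto Y atTop (𝓝 t) := by
    simpa using (hκ.pow l).mul_const t
  have hk4 : Tendsto (fun n => κ n ^ (4 * l) - 1) atTop (𝓝 0) := by
    simpa using (hκ.pow (4 * l)).sub_const 1
  have hB : Tendsto (fun n : ℕ => ((m₀ : ℝ) + 1) * β n + 2 * Y n * (1 / (n : ℝ))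
      + Y n * (κ n ^ (4 * l) - 1 + c * (κ n * β n + κ n * β n) + κ n * β n)) atTop (𝓝 0) := by
    have h1 := hdecay.const_mul ((m₀ : ℝ) + 1)
    have h2 := (hYlim.const_mul 2).mul (tendsto_one_div_atTop_nhds_zero_nat (𝕜 := ℝ))
    have h3 := hYlim.mul ((hk4.add ((hκβ.add hκβ).const_mul c)).add hκβ)
    simpa using (h1.add h2).add h3
  refine squeeze_zero_norm' ?_ hB
  filter_upwards [hQ, hκβ.eventually (gt_mem_nhds zero_lt_one), eventually_ge_atTop 2]
    with n hQn hβ1 hn2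
  set p := P.real (cylinder ω n) with hp
  set b := n ^ 2 with hb
  set N := returnTime P l t ω n with hN
  set M := N / b - m₀ with hM
  have hb2 : 2 * n ≤ b := by rw [hb]; nlinarith
  have hbcast : (b : ℝ) = (n : ℝ) ^ 2 := by rw [hb]; push_cast; rfl
  have hn1 : 1 ≤ n := by omega
  have hp0 : 0 ≤ p := measureReal_nonneg
  have hq0 : 0 ≤ κ n * p := mul_nonneg (by linarith [hκ1 n]) hp0
  have hn1' : (1 : ℝ) ≤ n := by exact_mod_cast hn1
  have hbq : b * (κ n * p) = κ n * β n := by rw [hbcast, hβ]; ring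
  have hqle : κ n * p ≤ κ n * β n := by
    rw [← hbq, hbcast]
    exact le_mul_of_one_le_left hq0 (one_le_pow₀ hn1')
  have hq1 : κ n * p ≤ 1 := hqle.trans hβ1.le
  set X := b * (κ n * p) ^ l with hX
  have hX0 : 0 ≤ X := by positivity
  have hXle : X ≤ κ n * β n := by
    rw [← hbq]
    exact mul_le_mul_of_nonneg_left (pow_le_of_le_one hq0 hq1 (by omega)) (Nat.cast_nonneg _)
  have hMX : M * X ≤ Y n := numBlocks_mul_le ht.le (by linarith [hκ1 n]) ω n b m₀
  have e1 := abs_integral_pow_count_sub_prod_le (P := P) (d := d) ω (n := n) (m₀ := m₀)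
    (show 1 ≤ b by omega) (by omega) N hz0 hz1
  have e2 := integral_countOn_remainder_le hinv (hκ1 n) hl hd ω hn1 (hU n) hb2
    (show 1 ≤ m₀ by omega) N
  have e3 := abs_integral_prod_block_sub_exp_le hinv (hκ1 n) hl hd hd1 ω hn1 (hU n) hQn hb2 hm₀
    hz0 hz1 (hXle.trans hβ1.le) M
  rw [sum_integral_one_sub_pow] at e3
  rw [← hp, ← hM] at e2
  rw [← hp, ← hX, ← hc] at e3
  rw [Real.norm_eq_abs]
  refine (abs_sub_le _ (∫ x, ∏ i ∈ Finset.range M,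
    z ^ countOn d (cylinder ω n) (block m₀ b n i) x ∂P) _).trans ?_
  have f1 : (M : ℝ) * (2 * n * (κ n * p) ^ l) ≤ 2 * Y n * (1 / (n : ℝ)) := by
    rw [mul_one_div, le_div_iff₀ (by linarith)]
    calc (M : ℝ) * (2 * n * (κ n * p) ^ l) * n = 2 * (M * X) := by rw [hX, hbcast]; ring
      _ ≤ 2 * Y n := by linarith
  have hk0 : 0 ≤ κ n ^ (4 * l) - 1 := sub_nonneg.2 (one_le_pow₀ (hκ1 n))
  have hc0 : 0 ≤ c := Nat.cast_nonneg _
  have hκβ0 : 0 ≤ κ n * β n := hX0.trans hXle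
  have f2 : (M : ℝ) * ((κ n ^ (4 * l) - 1) * X
      + c * ((b : ℝ) ^ 2 * (κ n * p) ^ (l + 1) + X ^ 2) + X ^ 2)
      ≤ Y n * (κ n ^ (4 * l) - 1 + c * (κ n * β n + κ n * β n) + κ n * β n) := by
    -- One factor X comes out of each term; in particular b² (κp)^{ℓ+1} = X · b κp.
    calc _ = (M * X) * (κ n ^ (4 * l) - 1 + c * (b * (κ n * p) + X) + X) := by
          rw [hX]; ring
      _ ≤ (M * X) * (κ n ^ (4 * l) - 1 + c * (κ n * β n + κ n * β n) + κ n * β n) := by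
          rw [hbq]; gcongr
      _ ≤ _ := by
          refine mul_le_mul_of_nonneg_right hMX ?_
          positivity
  have f3 : ((m₀ : ℝ) + 1) * (b * p) = ((m₀ : ℝ) + 1) * β n := by rw [hbcast]
  linarith

/-- The fewer than n times k < n contribute at most n p in total. For k ≥ n the windows are
disjoint, so mixing with gap 0 and a fixed constant suffices. -/
theorem exists_integral_returnCount_le (hinv : MeasurePreserving (shift : (ℕ → 𝒜) → (ℕ → 𝒜)) P P)
    {κ : ℝ} (hκ : 1 ≤ κ) (hU : UpperMix P 0 κ) (hl : 1 ≤ l) (hd : StrictMono d) {t : ℝ}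
    (ht : 0 < t) (ω : ℕ → 𝒜)
    (hdecay : Tendsto (fun n : ℕ => (n : ℝ) ^ 2 * P.real (cylinder ω n)) atTop (𝓝 0)) :
    ∃ C : ℝ, ∀ n, 1 ≤ n →
      ∫ x, (returnCount d (cylinder ω n) (returnTime P l t ω n) x : ℝ) ∂P ≤ C := by
  obtain ⟨C, hC⟩ := hdecay.bddAbove_range
  refine ⟨C + κ ^ l * t, fun n hn => ?_⟩
  set p := P.real (cylinder ω n) with hp
  set N := returnTime P l t ω n with hN
  have hp0 : 0 ≤ p := measureReal_nonneg
  have hκ0 : 0 ≤ κ := by linarith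
  have hq0 : 0 ≤ (κ * p) ^ l := by positivity
  have hn1 : (1 : ℝ) ≤ n := by exact_mod_cast hn
  rw [returnCount_eq_countOn, integral_countOn]
  calc _ ≤ ∑ k ∈ Finset.Icc 1 N, ((if k < n then p else 0) + (κ * p) ^ l) := by
        refine Finset.sum_le_sum fun k _ => ?_
        split_ifs with hk
        · exact (real_returnEvent_le_cylinder d hinv hl ω n k).trans (by linarith)
        · rw [zero_add]
          exact real_returnEvent_le hinv hκ hU hd ω hn (by omega)
    _ = ((Finset.Icc 1 N).filter (· < n)).card * p + N * (κ * p) ^ l := by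
        rw [Finset.sum_add_distrib, ← Finset.sum_filter]
        simp
    _ ≤ n * p + κ ^ l * (N * p ^ l) := by
        have : ((Finset.Icc 1 N).filter (· < n)).card ≤ n := by
          calc _ ≤ (Finset.range n).card := Finset.card_le_card fun k hk =>
                Finset.mem_range.2 (Finset.mem_filter.1 hk).2
            _ = n := Finset.card_range n
        rw [mul_pow]
        have h2 : (((Finset.Icc 1 N).filter (· < n)).card : ℝ) * p ≤ n * p := by gcongr
        have h3 : (N : ℝ) * (κ ^ l * p ^ l) = κ ^ l * (N * p ^ l) := by ring
        linarith
    _ ≤ C + κ ^ l * t := by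
        have h1 : (n : ℝ) ^ 2 * p ≤ C := hC ⟨n, rfl⟩
        have h2 : (n : ℝ) * p ≤ (n : ℝ) ^ 2 * p := by
          gcongr
          nlinarith
        have h3 : κ ^ l * (N * p ^ l) ≤ κ ^ l * t := by
          gcongr
          exact returnTime_mul_le ht.le ω n
        linarith

theorem integral_countLaw (t : ℝ) (ω : ℕ → 𝒜) (n : ℕ) (f : ℕ → ℝ) :
    ∫ i, f i ∂(countLaw P d t ω n : Measure ℕ)
      = ∫ x, f (returnCount d (cylinder ω n) (returnTime P l t ω n) x) ∂P :=
  integral_map (measurable_returnCount d (measurableSet_cylinder ω n) _).aemeasurable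
    (measurable_from_top (f := f)).aestronglyMeasurable

theorem isTightMeasureSet_countLaw {t C : ℝ} (ω : ℕ → 𝒜)
    (hC : ∀ n, 1 ≤ n →
      ∫ x, (returnCount d (cylinder ω n) (returnTime P l t ω n) x : ℝ) ∂P ≤ C) :
    IsTightMeasureSet {μ : Measure ℕ | ∃ n, 1 ≤ n ∧ μ = (countLaw P d t ω n : Measure ℕ)} := by
  rw [isTightMeasureSet_iff_exists_isCompact_measure_compl_le]
  intro ε hε
  have hlim : Tendsto (fun J : ℕ => ENNReal.ofReal (C / J)) atTop (𝓝 0) := by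
    rw [← ENNReal.ofReal_zero]
    exact ENNReal.tendsto_ofReal (tendsto_const_div_atTop_nhds_zero_nat C)
  obtain ⟨J, hJ, hJ1⟩ := ((hlim.eventually (gt_mem_nhds hε)).and (eventually_ge_atTop 1)).exists
  refine ⟨Set.Iio J, (Set.finite_Iio J).isCompact, ?_⟩
  rintro _ ⟨n, hn, rfl⟩
  have hmeas := measurable_returnCount d (measurableSet_cylinder ω n) (returnTime P l t ω n)
  have hlaw : (countLaw P d t ω n : Measure ℕ) (Set.Iio J)ᶜ
      = P {x | (J : ℝ) ≤ returnCount d (cylinder ω n) (returnTime P l t ω n) x} := by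
    change P.map _ _ = _
    rw [Measure.map_apply hmeas (MeasurableSet.of_discrete)]
    congr 1
    ext x
    simp
  rw [hlaw, ← ofReal_measureReal]
  refine le_trans (ENNReal.ofReal_le_ofReal ?_) hJ.le
  have hJ0 : (0 : ℝ) < J := by exact_mod_cast hJ1
  rw [le_div_iff₀ hJ0, mul_comm]
  refine le_trans (mul_meas_ge_le_integral_of_nonneg (ae_of_all _ fun x => Nat.cast_nonneg _)
    ?_ _) (hC n hn)
  rw [returnCount_eq_countOn]
  exact integrable_countOn d ω n _

end Limit

end CylinderReturns

open CylinderReturns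

/-! ### Tightness and identification of the limits -/

theorem theorem3p6 {𝒜 : Type*} [Countable 𝒜] [Nontrivial 𝒜]
    [MeasurableSpace 𝒜] [DiscreteMeasurableSpace 𝒜]
    (P : Measure (ℕ → 𝒜)) [IsProbabilityMeasure P]
    (hinv : MeasurePreserving (shift : (ℕ → 𝒜) → (ℕ → 𝒜)) P P)
    (hmix : IsPsiMixing P)
    (hP : ∀ x : ℕ → 𝒜, P ≠ Measure.dirac x)
    {l : ℕ} (hl : 1 ≤ l) (d : Fin l → ℕ) (hd : StrictMono d) (hd1 : ∀ j, 1 ≤ d j)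
    (t : ℝ) (ht : 0 < t)
    (ω : ℕ → 𝒜) (hsupp : ∀ n, 1 ≤ n → 0 < P (cylinder ω n))
    (hper : ω ∈ Function.periodicPts (shift : (ℕ → 𝒜) → (ℕ → 𝒜))) :
    IsTightMeasureSet {μ : Measure ℕ | ∃ n, 1 ≤ n ∧ μ = (countLaw P d t ω n : Measure ℕ)} ∧
    ∀ (μ : ProbabilityMeasure ℝ) (s : ℕ → ℕ), StrictMono s → (∀ k, 1 ≤ s k) →
      Tendsto (fun k => onReal (countLaw P d t ω (s k))) atTop (𝓝 μ) →
        ∃ (τ : ℝ≥0) (θ : Measure ℕ), IsProbabilityMeasure θ ∧ 0 < τ ∧ (τ : ℝ) ≤ t ∧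
          (μ : Measure ℝ) = (compoundPoisson τ θ).map (fun k : ℕ => (k : ℝ)) := by
  obtain ⟨κ, hκ1, hκ, hU, hQ⟩ := hmix.exists_rate
  have hdecay := tendsto_sq_mul_real_cylinder hκ hU hP ω hper
  constructor
  · obtain ⟨C, hC⟩ := exists_integral_returnCount_le hinv (hκ1 0) (hU 0) hl hd ht ω hdecay
    exact isTightMeasureSet_countLaw ω hC
  · intro μ s hs _ hμ
    obtain ⟨ρ, hρ, hμρ, hρlim⟩ := exists_measure_nat_of_tendsto_onReal hμ
    have hs_top := hs.tendsto_atTop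
    set m₀ := ∑ j, d j + 2 with hm₀
    set Λ : ℕ → ℕ → ℝ := fun n =>
      blockTail P d ω m₀ (n ^ 2) n (returnTime P l t ω n / n ^ 2 - m₀) with hΛ
    have hY : Tendsto (fun k => κ (s k) ^ l * t) atTop (𝓝 t) := by
      simpa using ((hκ.comp hs_top).pow l).mul_const t
    -- A further subsequence is harmless, since the laws already converge to μ along s.
    obtain ⟨φ, L, hφ, hLanti, hL0, hLt, hLlim⟩ := exists_subseq_tendsto_tail
      (Λ := fun k => Λ (s k)) hY (fun k j => blockTail_nonneg ω _ _ _ _ j)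
      (fun k => blockTail_anti ω _ _ _ _) (by
        filter_upwards [hs_top.eventually (eventually_ge_atTop 2)] with k hk j
        exact (mul_blockTail_le hinv (hκ1 (s k)) hd ω (by omega) (hU (s k)) (by nlinarith)
          (by omega) _ j).trans
          (numBlocks_mul_le ht.le (by linarith [hκ1 (s k)]) ω (s k) (s k ^ 2) m₀))
    obtain ⟨θ, hθ, hθz⟩ := exists_isProbabilityMeasure_of_tail ht hLanti hL0 hLt
    -- The full parameter t is kept; blocks without returns are accounted for by the atom of θ at 0.
    let τ : ℝ≥0 := ⟨t, ht.le⟩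
    refine ⟨τ, θ, hθ, ht, le_rfl, ?_⟩
    suffices hρθ : ρ = compoundPoisson τ θ by rw [hμρ, hρθ]
    refine ext_of_lintegral_pow fun z hz0 hz1 => ?_
    obtain ⟨hG0, hG⟩ := hθz z hz0.le hz1
    rw [lintegral_pow_compoundPoisson _ θ hz0.le hG0 hG, ← ofReal_integral_eq_lintegral_ofReal
      (integrable_of_mem_Icc measurable_from_top (fun k => pow_nonneg hz0.le k)
        fun k => pow_le_one₀ hz0.le hz1.le) (ae_of_all _ fun k => pow_nonneg hz0.le k)]
    congr 1
    have h1 := (hρlim z hz0 hz1).comp hφ.tendsto_atTop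
    have h2 := (tendsto_integral_pow_sub_exp hinv hκ1 hκ hU hQ hl hd hd1 ht ω hdecay
      (show ∑ j, d j + 2 ≤ m₀ from le_rfl) hz0.le hz1.le).comp (hs_top.comp hφ.tendsto_atTop)
    have h3 := (Real.continuous_exp.tendsto _).comp ((hLlim z hz0.le hz1).const_mul (1 - z)).neg
    have h4 := h2.add h3
    -- Along the subsequence the generating function tends both to that of ρ and to exp(-(1 - z) ∑
    -- z^j L_j), which is exp(t (G - 1)) for the generating function G of θ.
    refine tendsto_nhds_unique h1 ?_
    convert! h4 using 1
    · funext k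
      simp only [Function.comp, integral_countLaw, hΛ, sub_add_cancel]
    · congr 1
      rw [zero_add]
      congr 1
      change t * _ = _
      field_simp
      ring
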